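/- Notation. For $\varepsilon=\pm1$ put $(z,w)_\varepsilon=\sum_{i=1}^{k}z_i\bar w_i+\varepsilon z_{k+1}\bar w_{k+1}$ on $\mathbb C^{k+1}$, and let $\mathbb S^{2k+1}=\{(z,z)_{1}=1\}$ and $\mathbb H^{2k+1}_1=\{(z,z)_{-1}=-1\}$. Then $\mathbb{CP}^k=\mathbb S^{2k+1}/\mathbb S^1$ and $\mathbb{CH}^k=\mathbb H_1^{2k+1}/\mathbb S^1$ carry the metrics of holomorphic sectional curvature $4$ and $-4$ for which the Hopf projection $z\mapsto[z]$ is a (pseudo-)Riemannian submersion for $\Re(\cdot,\cdot)_\varepsilon$, with complex structure $J$ induced by multiplication by $i$; $\mathbb C^k$ carries the Euclidean metric $\langle\cdot,\cdot\rangle$ and $J=i$. A minimal Lagrangian immersion of a manifold $M$ of real dimension $k$ into one of these spaces is a smooth immersion which pulls the Kähler form $\langle J\cdot,\cdot\rangle$ back to $0$ and whose mean curvature vector vanishes. A horizontal lift of $\phi:M\to\mathbb{CP}^k$ (or $\mathbb{CH}^k$) is a smooth map $\tilde\phi$ to $\mathbb S^{2k+1}$ (or $\mathbb H^{2k+1}_1$)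 with $[\tilde\phi]=\phi$ and $(d\tilde\phi(v),\tilde\phi)=0$ for all tangent vectors $v$. Proposition 4. Let $n\ge1$ and let $N$ be a smooth manifold of dimension $n-1$. a) Let $\phi:N\to\mathbb{CP}^{n-1}$ be a minimal Lagrangian immersion. If $N$ is simply connected, $\phi$ has a horizontal lift $\tilde\phi:N\to\mathbb S^{2n-1}$. For every horizontal lift $\tilde\phi$ of $\phi$, the map $\mathbb R^+\times N\to\mathbb{CH}^n$, $(s,x)\mapsto[(\sinh s\,\tilde\phi(x),\cosh s)]$, with $\mathbb R^+=(0,\infty)$, is a minimal Lagrangian immersion. b) Let $\psi:N\to\mathbb{CH}^{n-1}$ be a minimal Lagrangian immersion. If $N$ is simply connected, $\psi$ has a horizontal lift $\tilde\psi:N\to\mathbb H^{2n-1}_1$. For every horizontal lift $\tilde\psi$ of $\psi$, the map $\mathbb R\times N\to\mathbb{CH}^n$, $(s,x)\mapsto[(\sinh s,\cosh s\,\tilde\psi(x))]$, is a minimal Lagrangian immersion. c) Let $\eta:N\to\mathbb C^{n-1}$ be a minimal Lagrangian immersion and let $f:N\to\mathbb C$ satisfy $\Re f=|\eta|^2$ and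 $v(\Im f)=2\langle\eta_*v,J\eta\rangle$ for every vector $v$ tangent to $N$ (with $\Im f$ differentiable). Then the map $\mathbb R\times N\to\mathbb{CH}^n$, $$(s,x)\mapsto\left[e^s\left(\eta(x),\tfrac{f(x)}2,\tfrac{f(x)}2\right)+(0,-\sinh s,\cosh s)\right],$$ is a minimal Lagrangian immersion. -/

import Mathlib

open scoped Manifold ContDiff

noncomputable section

namespace MinLag

/-! ### Complex space forms as quotients of quadrics

The sign `ε = 1` gives the unit sphere and complex projective space (holomorphic sectional
curvature `4`); the sign `ε = -1` gives anti-de Sitter space and complex hyperbolic space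
(holomorphic sectional curvature `-4`). -/

/-- The Hermitian form `z₁ w̄₁ + ⋯ + zₖ w̄ₖ + ε zₖ₊₁ w̄ₖ₊₁` on `ℂ^(k+1)`, with `ε = ±1`. -/
def herm (ε : ℤˣ) {k : ℕ} (z w : Fin (k + 1) → ℂ) : ℂ :=
  (∑ i : Fin k, z i.castSucc * starRingEnd ℂ (w i.castSucc))
    + ((ε : ℤ) : ℂ) * (z (Fin.last k) * starRingEnd ℂ (w (Fin.last k)))

/-- The quadric `(z, z) = ε`: the unit sphere `S^(2k+1)` if `ε = 1`, the anti-de Sitter space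
`H₁^(2k+1)` if `ε = -1`. -/
def Quadric (ε : ℤˣ) (k : ℕ) : Type :=
  {z : Fin (k + 1) → ℂ // herm ε z z = ((ε : ℤ) : ℂ)}

/-- Two points of the quadric are equivalent if they differ by a unit complex factor. -/
def circleSetoid (ε : ℤˣ) (k : ℕ) : Setoid (Quadric ε k) where
  r z w := ∃ c : Circle, w.1 = (c : ℂ) • z.1
  iseqv :=
    { refl := fun z => ⟨1, by simp⟩
      symm := by
        rintro z w ⟨c, h⟩
        exact ⟨c⁻¹, by rw [h, smul_smul, ← Circle.coe_mul]; simp⟩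
      trans := by
        rintro z w v ⟨c, h⟩ ⟨d, h'⟩
        exact ⟨d * c, by rw [h', h, smul_smul, Circle.coe_mul]⟩ }

/-- The complex space form: the quadric modulo the circle action. -/
def SpaceForm (ε : ℤˣ) (k : ℕ) : Type := Quotient (circleSetoid ε k)

/-- Complex projective space `ℂP^k = S^(2k+1) / S¹`. -/
abbrev CP (k : ℕ) : Type := SpaceForm 1 k

/-- Complex hyperbolic space `ℂH^k = H₁^(2k+1) / S¹`. -/
abbrev CH (k : ℕ) : Type := SpaceForm (-1) k

/-- The Hopf projection `z ↦ [z]`. -/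
def hopf {ε : ℤˣ} {k : ℕ} (z : Quadric ε k) : SpaceForm ε k := Quotient.mk (circleSetoid ε k) z

/-! ### Immersions: mean curvature

`g` is the real inner product on the ambient tangent space, `df a` the differential of the immersion
on the tangent vector `a`, and `B a b` the ambient covariant derivative, in the direction of `a`, of
the image of the coordinate vector field `b`. -/

/-- The part of `w` normal to the immersion, for an orthonormal basis `e` of the tangent space. -/
def normalPart {E V : Type*} [AddCommGroup V] [Module ℝ V] {n : ℕ} (g : V → V → ℝ) (df : E → V)
    (e : Fin n → E) (w : V) : V :=
  w - ∑ j, g w (df (e j)) • df (e j)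

/-- The mean curvature vector `(1/n) ∑ᵢ σ(eᵢ, eᵢ)`, where `e` is an orthonormal basis of the tangent
space and the second fundamental form `σ(a, b)` is the normal part of `B a b`. -/
def meanCurvature {E V : Type*} [AddCommGroup V] [Module ℝ V] {n : ℕ} (g : V → V → ℝ) (df : E → V)
    (B : E → E → V) (e : Fin n → E) : V :=
  (1 / (n : ℝ)) • ∑ i, normalPart g df e (B (e i) (e i))

/-- At one point: an immersion which is Lagrangian (half-dimensional, with vanishing pull-back of the
Kähler form `⟨Ju, v⟩`) and has mean curvature zero. -/
structure MinLagAt (n : ℕ) {E V : Type*} [AddCommGroup E] [Module ℝ E] [AddCommGroup V] [Module ℝ V]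
    [Module ℂ V] (g : V → V → ℝ) (df : E → V) (B : E → E → V) : Prop where
  dim : Module.finrank ℝ E = n
  immersion : Function.Injective df
  lagrangian : ∀ a b, g (Complex.I • df a) (df b) = 0
  minimal : ∀ e : Fin n → E,
    (∀ i j, g (df (e i)) (df (e j)) = if i = j then 1 else 0) → meanCurvature g df B e = 0

/-! ### Geometry of a complex space form through lifts

The tangent space of the space form at `[z]` is identified, by the differential of the Hopf
projection, with the horizontal space `{w | (w, z) = 0}`; the metric is `Re ( , )` there and the
complex structure is multiplication by `i`. In what follows `u` is a (not necessarily horizontal)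
lift to the quadric of a map from an open subset of `E` to the space form. -/

/-- The projection to the horizontal space at the point `z` of the quadric. -/
def horProj (ε : ℤˣ) {k : ℕ} (z w : Fin (k + 1) → ℂ) : Fin (k + 1) → ℂ :=
  w - (((ε : ℤ) : ℂ) * herm ε w z) • z

/-- The real part of the Hermitian form. -/
def reHerm (ε : ℤˣ) {k : ℕ} (z w : Fin (k + 1) → ℂ) : ℝ := (herm ε z w).re

/-- The horizontal vector at `u y` that represents the differential, applied to `a`, of the map
lifted by `u`. -/
def dHor (ε : ℤˣ) {k : ℕ} {E : Type*} [NormedAddCommGroup E] [NormedSpace ℝ E]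
    (u : E → Fin (k + 1) → ℂ) (y : E) (a : E) : Fin (k + 1) → ℂ :=
  horProj ε (u y) (fderiv ℝ u y a)

/-- The horizontal vector at `u y` that represents the Levi-Civita derivative, in the direction of
`a`, of the vector field `dHor u · b` along the map lifted by `u`. The derivative of `u` in the
direction of `a` is `dHor u y a + λ u y` with `λ` imaginary. The Levi-Civita connection of the base
of the (pseudo-)Riemannian submersion is the horizontal part of the ambient derivative if `λ = 0`;
in general the derivative of the field in the fibre direction `λ u`, which is `λ` times the field
(horizontal lifts are invariant under the circle), has to be subtracted. -/
def covHor (ε : ℤˣ) {k : ℕ} {E : Type*} [NormedAddCommGroup E] [NormedSpace ℝ E]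
    (u : E → Fin (k + 1) → ℂ) (y : E) (a b : E) : Fin (k + 1) → ℂ :=
  horProj ε (u y) (fderiv ℝ (fun x => dHor ε u x b) y a)
    - (((ε : ℤ) : ℂ) * herm ε (fderiv ℝ u y a) (u y)) • dHor ε u y b

section Manifold

variable {E : Type*} [NormedAddCommGroup E] [NormedSpace ℝ E] {H : Type*} [TopologicalSpace H]
  (I : ModelWithCorners ℝ E H) {M : Type*} [TopologicalSpace M] [ChartedSpace H M]

/-- `F` is a smooth lift to the quadric of the map `φ`, on a neighbourhood `U` of `p`. -/
structure IsLocalLift {ε : ℤˣ} {k : ℕ} (φ : M → SpaceForm ε k) (p : M) (U : Set M)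
    (F : M → Fin (k + 1) → ℂ) : Prop where
  isOpen : IsOpen U
  mem : p ∈ U
  smooth : ContMDiffOn I 𝓘(ℝ, Fin (k + 1) → ℂ) ∞ F U
  lifts : ∀ x ∈ U, ∃ h : herm ε (F x) (F x) = ((ε : ℤ) : ℂ), hopf ⟨F x, h⟩ = φ x

/-- `φ` is a minimal Lagrangian immersion of the manifold `M` (without boundary) in a complex space
form. Smoothness of `φ` means that it has smooth lifts near every point (the Hopf projection is a
submersion); the conditions at `p` are those of the coordinate expression, in the chart at `p`, of
any smooth lift near `p`. -/
structure IsMinLag {ε : ℤˣ} {k : ℕ} (φ : M → SpaceForm ε k) : Prop where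
  smooth : ∀ p : M, ∃ U F, IsLocalLift I φ p U F
  minLag : ∀ (p : M) (U : Set M) (F : M → Fin (k + 1) → ℂ), IsLocalLift I φ p U F →
    MinLagAt k (reHerm ε) (dHor ε (F ∘ (extChartAt I p).symm) (extChartAt I p p))
      (covHor ε (F ∘ (extChartAt I p).symm) (extChartAt I p p))

/-- `G` is a horizontal lift of `φ` to the quadric. -/
structure IsHorizontalLift {ε : ℤˣ} {k : ℕ} (φ : M → SpaceForm ε k) (G : M → Quadric ε k) :
    Prop where
  smooth : ContMDiff I 𝓘(ℝ, Fin (k + 1) → ℂ) ∞ (fun x => (G x).1)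
  lifts : ∀ x, hopf (G x) = φ x
  horizontal : ∀ (x : M) (v : TangentSpace I x),
    herm ε (mfderiv I 𝓘(ℝ, Fin (k + 1) → ℂ) (fun x => (G x).1) x v : Fin (k + 1) → ℂ) (G x).1 = 0

/-- The Euclidean inner product `Re ∑ᵢ zᵢ w̄ᵢ` on `ℂ^m`. -/
def reFlat {m : ℕ} (z w : Fin m → ℂ) : ℝ := (∑ i, z i * starRingEnd ℂ (w i)).re

/-- `η` is a minimal Lagrangian immersion of the manifold `M` (without boundary) in `ℂ^m`. -/
structure IsMinLagFlat {m : ℕ} (η : M → Fin m → ℂ) : Prop where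
  smooth : ContMDiff I 𝓘(ℝ, Fin m → ℂ) ∞ η
  minLag : ∀ p : M,
    MinLagAt m reFlat (fderiv ℝ (η ∘ (extChartAt I p).symm) (extChartAt I p p))
      (fun a b => fderiv ℝ (fun x => fderiv ℝ (η ∘ (extChartAt I p).symm) x b) (extChartAt I p p) a)

/-- The condition on `f : M → ℂ`: `Re f = |η|²` and `v (Im f) = 2 ⟨η_* v, J η⟩` for all tangent
vectors `v`. -/
structure IsPotential {m : ℕ} (η : M → Fin m → ℂ) (f : M → ℂ) : Prop where
  re_eq : ∀ x, (f x).re = reFlat (η x) (η x)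
  differentiable : MDifferentiable I 𝓘(ℝ, ℝ) (fun x => (f x).im)
  im_eq : ∀ (x : M) (v : TangentSpace I x),
    (mfderiv I 𝓘(ℝ, ℝ) (fun x => (f x).im) x v : ℝ)
      = 2 * reFlat (mfderiv I 𝓘(ℝ, Fin m → ℂ) η x v : Fin m → ℂ) (Complex.I • η x)

end Manifold

/-! ### The three maps into complex hyperbolic space -/

/-- The vector `(z₁, …, zₖ, a)`. -/
def append {k : ℕ} (z : Fin k → ℂ) (a : ℂ) : Fin (k + 1) → ℂ := Fin.snoc (α := fun _ => ℂ) z a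

/-- The vector `(a, z₁, …, zₖ)`. -/
def prepend {k : ℕ} (a : ℂ) (z : Fin k → ℂ) : Fin (k + 1) → ℂ := Fin.cons (α := fun _ => ℂ) a z

theorem herm_append {ε : ℤˣ} {k : ℕ} (z w : Fin k → ℂ) (a b : ℂ) :
    herm ε (append z a) (append w b)
      = (∑ i, z i * starRingEnd ℂ (w i)) + ((ε : ℤ) : ℂ) * (a * starRingEnd ℂ b) := by
  simp [herm, append]

theorem cosh_sq_ofReal (s : ℝ) :
    (Real.cosh s : ℂ) * Real.cosh s = Real.sinh s * Real.sinh s + 1 := by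
  have h := Real.cosh_sq s
  exact_mod_cast (by linarith [h, sq (Real.cosh s), sq (Real.sinh s)] :
    Real.cosh s * Real.cosh s = Real.sinh s * Real.sinh s + 1)

theorem mapA_mem {k : ℕ} (s : ℝ) (z : Quadric 1 k) :
    herm (-1) (append ((Real.sinh s : ℂ) • z.1) (Real.cosh s))
      (append ((Real.sinh s : ℂ) • z.1) (Real.cosh s)) = (((-1 : ℤˣ) : ℤ) : ℂ) := by
  have hz := z.2
  simp only [herm, Units.val_one, Int.cast_one, one_mul] at hz
  rw [herm_append, Fin.sum_univ_castSucc]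
  have hsum : ∀ w : ℂ, (Real.sinh s : ℂ) * w * starRingEnd ℂ ((Real.sinh s : ℂ) * w)
      = (Real.sinh s : ℂ) * Real.sinh s * (w * starRingEnd ℂ w) := by
    intro w
    rw [map_mul, Complex.conj_ofReal]
    ring
  simp only [Pi.smul_apply, smul_eq_mul, hsum]
  rw [← Finset.mul_sum, ← mul_add, hz, Complex.conj_ofReal, cosh_sq_ofReal]
  push_cast
  ring

theorem mapB_mem {k : ℕ} (s : ℝ) (z : Quadric (-1) k) :
    herm (-1) (prepend (Real.sinh s) ((Real.cosh s : ℂ) • z.1))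
      (prepend (Real.sinh s) ((Real.cosh s : ℂ) • z.1)) = (((-1 : ℤˣ) : ℤ) : ℂ) := by
  have hz := z.2
  simp only [herm] at hz
  have hsum : ∀ w : ℂ, (Real.cosh s : ℂ) * w * starRingEnd ℂ ((Real.cosh s : ℂ) * w)
      = (Real.cosh s : ℂ) * Real.cosh s * (w * starRingEnd ℂ w) := by
    intro w
    rw [map_mul, Complex.conj_ofReal]
    ring
  have h1 : herm (-1) (prepend (Real.sinh s) ((Real.cosh s : ℂ) • z.1))
      (prepend (Real.sinh s) ((Real.cosh s : ℂ) • z.1))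
      = (Real.sinh s : ℂ) * Real.sinh s + (Real.cosh s : ℂ) * Real.cosh s * herm (-1) z.1 z.1 := by
    simp only [herm, prepend]
    rw [Fin.sum_univ_succ, ← Fin.succ_last]
    simp only [Fin.castSucc_zero, Fin.cons_zero, ← Fin.succ_castSucc, Fin.cons_succ,
      Pi.smul_apply, smul_eq_mul, hsum, Complex.conj_ofReal]
    rw [← Finset.mul_sum]
    ring
  rw [h1, z.2, cosh_sq_ofReal]
  push_cast
  ring

theorem mapC_mem {m : ℕ} (s : ℝ) (z : Fin m → ℂ) (w : ℂ) (h : w.re = reFlat z z) :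
    herm (-1)
      ((Real.exp s : ℂ) • append (append z (w / 2)) (w / 2)
        + append (append (0 : Fin m → ℂ) (-(Real.sinh s : ℂ))) (Real.cosh s))
      ((Real.exp s : ℂ) • append (append z (w / 2)) (w / 2)
        + append (append (0 : Fin m → ℂ) (-(Real.sinh s : ℂ))) (Real.cosh s))
      = (((-1 : ℤˣ) : ℤ) : ℂ) := by
  have hsum : ∀ w : ℂ, (Real.exp s : ℂ) * w * starRingEnd ℂ ((Real.exp s : ℂ) * w)
      = (Real.exp s : ℂ) * Real.exp s * (w * starRingEnd ℂ w) := by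
    intro w
    rw [map_mul, Complex.conj_ofReal]
    ring
  have hre : (∑ i, z i * starRingEnd ℂ (z i)) = (w.re : ℂ) := by
    rw [h, reFlat]
    apply Complex.ext
    · simp
    · rw [Complex.im_sum, Complex.ofReal_im]
      exact Finset.sum_eq_zero fun i _ => by rw [Complex.mul_conj]; exact Complex.ofReal_im _
  have hw : w + starRingEnd ℂ w = 2 * (w.re : ℂ) := by
    rw [Complex.add_conj]; push_cast; ring
  have hexp : (Real.exp s : ℂ) = Real.cosh s + Real.sinh s := by
    exact_mod_cast (Real.cosh_add_sinh s).symm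
  have hc := cosh_sq_ofReal s
  simp only [herm, append]
  rw [Fin.sum_univ_castSucc]
  simp only [Pi.add_apply, Pi.smul_apply, Fin.snoc_castSucc, Fin.snoc_last, smul_eq_mul,
    Pi.zero_apply, add_zero, hsum]
  rw [← Finset.mul_sum, hre]
  simp only [map_add, map_mul, map_neg, map_div₀, Complex.conj_ofReal, map_ofNat]
  push_cast at hexp hc hw ⊢
  rw [hexp]
  linear_combination ((-1 : ℂ)) * hc
    - (1 / 2) * (Complex.cosh s + Complex.sinh s) * (Complex.cosh s + Complex.sinh s) * hw

/-- The open half-line `ℝ⁺ = (0, ∞)`, as an open submanifold of `ℝ`. -/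
def posReal : TopologicalSpace.Opens ℝ := ⟨Set.Ioi 0, isOpen_Ioi⟩

variable {N : Type*} {m : ℕ}

/-- `(s, x) ↦ [(sinh s · G(x), cosh s)]` on `ℝ⁺ × N`. -/
def mapA (G : N → Quadric 1 m) : posReal × N → CH (m + 1) := fun q =>
  hopf ⟨append ((Real.sinh q.1 : ℂ) • (G q.2).1) (Real.cosh q.1), mapA_mem q.1 (G q.2)⟩

/-- `(s, x) ↦ [(sinh s, cosh s · G(x))]` on `ℝ × N`. -/
def mapB (G : N → Quadric (-1) m) : ℝ × N → CH (m + 1) := fun q =>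
  hopf ⟨prepend (Real.sinh q.1) ((Real.cosh q.1 : ℂ) • (G q.2).1), mapB_mem q.1 (G q.2)⟩

/-- `(s, x) ↦ [eˢ (η(x), f(x)/2, f(x)/2) + (0, -sinh s, cosh s)]` on `ℝ × N`. The vector lies in
anti-de Sitter space because `Re f = |η|²`. -/
def mapC (η : N → Fin m → ℂ) (f : N → ℂ) (h : ∀ x, (f x).re = reFlat (η x) (η x)) :
    ℝ × N → CH (m + 1) := fun q =>
  hopf ⟨(Real.exp q.1 : ℂ) • append (append (η q.2) (f q.2 / 2)) (f q.2 / 2)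
      + append (append (0 : Fin m → ℂ) (-(Real.sinh q.1 : ℂ))) (Real.cosh q.1),
    mapC_mem q.1 (η q.2) (f q.2) (h q.2)⟩

end MinLag

end

/-!
Each of the three maps has a lift to anti-de Sitter space of the form `u(s, x) = a(s) W(x) + κ(s)`
with `a'' = a` and `κ'' = κ` (a "cone", `MinLag.cone`):

* `W = (G, 0)`, `a = sinh`, `κ = (0, cosh)` over a horizontal lift `G` to the sphere;
* `W = (0, G)`, `a = cosh`, `κ = (sinh, 0)` over a horizontal lift `G` to anti-de Sitter space;
* `W = (η, f/2, f/2)`, `a = exp`, `κ = (0, -sinh, cosh)` over an immersion `η` in `ℂ^m`.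

In all cases `u` is horizontal, so the second fundamental form is the normal part of `D²u`, and the
induced metric is `ds² + a² h`, with `h` the metric of the given immersion. As `∂ₛ²u = u` is
vertical, the curves `x = const` are geodesics and the mean curvature is a multiple of the normal
part of `tr_h D²W`. By minimality of the given immersion this trace is tangent up to a complex multiple
of one vector `Z` (`(G, 0)`, `(0, G)` or `(0, 1, 1)`) in the real span of `u` and `∂ₛu`. Pairing with
`u` shows that the multiple is real, so that its horizontal part is a real multiple of the tangent
vector `∂ₛu` (`MinLag.minLagAt_cone`). The trace may be computed in any orthonormal frame
(`MinLag.IsFrame.trace_eq`), and the conditions do not depend on the lift (`MinLag.MinLagAt.gauge`),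
so it suffices to consider this one.

For the horizontal lift of a minimal Lagrangian immersion `φ`, take any local lift `u`. The
imaginary part of `(du, u)` is, up to sign, a connection form whose differential is the pull-back of
the Kähler form, hence zero. The Poincaré lemma gives `θ` such that `exp(iθ) u` is horizontal
(`MinLag.exists_horizontal_gauge`). Two local horizontal lifts differ by a locally constant element
of the circle, so on a simply connected manifold they can be glued, by the lifting property of the
covering space which the resulting cocycle defines
(`MinLag.exists_locallyConstant_of_cocycle`).
-/

noncomputable section

open Filter Topology

namespace MinLag

/-! ### The Hermitian form -/

section Herm

variable {ε : ℤˣ} {k : ℕ}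

theorem herm_add_left (z z' w : Fin (k + 1) → ℂ) :
    herm ε (z + z') w = herm ε z w + herm ε z' w := by
  simp only [herm, Pi.add_apply, add_mul, mul_add, Finset.sum_add_distrib]; ring

theorem herm_smul_left (c : ℂ) (z w : Fin (k + 1) → ℂ) :
    herm ε (c • z) w = c * herm ε z w := by
  simp only [herm, Pi.smul_apply, smul_eq_mul, mul_add, Finset.mul_sum, mul_assoc]; ring

theorem conj_herm (z w : Fin (k + 1) → ℂ) : starRingEnd ℂ (herm ε z w) = herm ε w z := by
  simp only [herm, map_add, map_sum, map_mul, Complex.conj_conj, map_intCast, mul_comm]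

theorem herm_add_right (z w w' : Fin (k + 1) → ℂ) :
    herm ε z (w + w') = herm ε z w + herm ε z w' := by
  rw [← conj_herm, herm_add_left, map_add, conj_herm, conj_herm]

theorem herm_smul_right (c : ℂ) (z w : Fin (k + 1) → ℂ) :
    herm ε z (c • w) = starRingEnd ℂ c * herm ε z w := by
  rw [← conj_herm, herm_smul_left, map_mul, conj_herm]

theorem herm_real_smul_left (r : ℝ) (z w : Fin (k + 1) → ℂ) :
    herm ε (r • z) w = r * herm ε z w := by
  rw [← Complex.coe_smul, herm_smul_left]

theorem herm_real_smul_right (r : ℝ) (z w : Fin (k + 1) → ℂ) :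
    herm ε z (r • w) = r * herm ε z w := by
  rw [← Complex.coe_smul, herm_smul_right, Complex.conj_ofReal]

theorem herm_zero_left (w : Fin (k + 1) → ℂ) : herm ε 0 w = 0 := by simp [herm]

theorem herm_zero_right (z : Fin (k + 1) → ℂ) : herm ε z 0 = 0 := by simp [herm]

theorem sign_mul_self (ε : ℤˣ) : ((ε : ℤ) : ℂ) * ((ε : ℤ) : ℂ) = 1 := by
  rcases Int.units_eq_one_or ε with rfl | rfl <;> simp

/-- The Hermitian form as a continuous real bilinear map. -/
def hermL (ε : ℤˣ) (k : ℕ) : (Fin (k + 1) → ℂ) →L[ℝ] (Fin (k + 1) → ℂ) →L[ℝ] ℂ :=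
  (LinearMap.mk₂ ℝ (herm ε) herm_add_left
    (fun r z w => by rw [herm_real_smul_left, Complex.real_smul]) herm_add_right
    (fun r z w => by rw [herm_real_smul_right, Complex.real_smul])).toContinuousBilinearMap

theorem hermL_apply (z w : Fin (k + 1) → ℂ) : hermL ε k z w = herm ε z w := rfl

/-- The real part of the Hermitian form as a real bilinear map. -/
def reHermL (ε : ℤˣ) (k : ℕ) : (Fin (k + 1) → ℂ) →ₗ[ℝ] (Fin (k + 1) → ℂ) →ₗ[ℝ] ℝ :=
  LinearMap.mk₂ ℝ (reHerm ε) (fun z z' w => by simp [reHerm, herm_add_left])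
    (fun r z w => by simp [reHerm, herm_real_smul_left])
    (fun z z' w => by simp [reHerm, herm_add_right])
    (fun r z w => by simp [reHerm, herm_real_smul_right])

theorem reHerm_comm (z w : Fin (k + 1) → ℂ) : reHerm ε z w = reHerm ε w z := by
  rw [reHerm, reHerm, ← conj_herm, Complex.conj_re]

theorem reHerm_I_smul_left (z w : Fin (k + 1) → ℂ) :
    reHerm ε (Complex.I • z) w = -(herm ε z w).im := by
  simp [reHerm, herm_smul_left]

/-- On the horizontal space at a point of the quadric the Hermitian form is positive definite. For
`ε = -1` this is the reversed Cauchy–Schwarz inequality of a Lorentzian form. -/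
theorem reHerm_self_pos {z w : Fin (k + 1) → ℂ} (hz : herm ε z z = ((ε : ℤ) : ℂ))
    (hw : herm ε w z = 0) (hw0 : w ≠ 0) : 0 < reHerm ε w w := by
  have key : ∀ v : Fin (k + 1) → ℂ, reHerm ε v v
      = ∑ i : Fin k, ‖v i.castSucc‖ ^ 2 + ((ε : ℤ) : ℝ) * ‖v (Fin.last k)‖ ^ 2 := by
    intro v
    have : herm ε v v = ((∑ i : Fin k, ‖v i.castSucc‖ ^ 2
        + ((ε : ℤ) : ℝ) * ‖v (Fin.last k)‖ ^ 2 : ℝ) : ℂ) := by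
      simp only [herm, Complex.mul_conj, Complex.normSq_eq_norm_sq]
      push_cast; rfl
    rw [reHerm, this, Complex.ofReal_re]
  have hne : (∀ i : Fin k, w i.castSucc = 0) → w (Fin.last k) ≠ 0 := by
    intro h h'
    apply hw0
    funext i
    induction i using Fin.lastCases with
    | last => exact h'
    | cast i => exact h i
  rw [key]
  set A := ∑ i : Fin k, ‖w i.castSucc‖ ^ 2 with hA
  have hA0 : 0 ≤ A := Finset.sum_nonneg fun i _ => by positivity
  have hAz : A = 0 → ∀ i : Fin k, w i.castSucc = 0 := by
    intro h i
    have := (Finset.sum_eq_zero_iff_of_nonneg (fun i _ => by positivity)).1 h i (Finset.mem_univ i)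
    simpa using this
  rcases Int.units_eq_one_or ε with rfl | rfl
  · rcases hA0.eq_or_lt with h | h
    · have := norm_pos_iff.2 (hne (hAz h.symm))
      simp only [Units.val_one, Int.cast_one, one_mul]
      positivity
    · simp only [Units.val_one, Int.cast_one, one_mul]
      positivity
  · have hz' := congrArg Complex.re hz
    rw [show (herm (-1) z z).re = reHerm (-1) z z from rfl, key] at hz'
    set C := ∑ i : Fin k, ‖z i.castSucc‖ ^ 2 with hC
    have hz1 : ‖z (Fin.last k)‖ ^ 2 = 1 + C := by
      simp at hz'; linarith
    have hC0 : 0 ≤ C := Finset.sum_nonneg fun i _ => by positivity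
    have hw' : w (Fin.last k) * starRingEnd ℂ (z (Fin.last k))
        = ∑ i : Fin k, w i.castSucc * starRingEnd ℂ (z i.castSucc) := by
      simp [herm] at hw
      linear_combination -hw
    have hcs : ‖w (Fin.last k)‖ ^ 2 * ‖z (Fin.last k)‖ ^ 2 ≤ A * C := by
      have h1 : ‖w (Fin.last k)‖ * ‖z (Fin.last k)‖
          ≤ ∑ i : Fin k, ‖w i.castSucc‖ * ‖z i.castSucc‖ := by
        calc _ = ‖w (Fin.last k) * starRingEnd ℂ (z (Fin.last k))‖ := by simp
          _ ≤ _ := by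
            rw [hw']
            refine (norm_sum_le _ _).trans (le_of_eq ?_)
            simp
      calc _ = (‖w (Fin.last k)‖ * ‖z (Fin.last k)‖) ^ 2 := by ring
        _ ≤ (∑ i : Fin k, ‖w i.castSucc‖ * ‖z i.castSucc‖) ^ 2 := by gcongr
        _ ≤ A * C := Finset.sum_mul_sq_le_sq_mul_sq _ _ _
    rw [hz1] at hcs
    simp only [Units.val_neg, Units.val_one, Int.cast_neg, Int.cast_one]
    have hB0 : 0 ≤ ‖w (Fin.last k)‖ ^ 2 := by positivity
    have hA1 : 0 < A := by
      refine hA0.lt_of_ne fun h => ?_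
      have h2 := norm_pos_iff.2 (hne (hAz h.symm))
      rw [← h] at hcs
      nlinarith [sq_pos_of_pos h2]
    nlinarith

theorem contDiff_herm : ContDiff ℝ ∞ (fun p : (Fin (k + 1) → ℂ) × (Fin (k + 1) → ℂ) =>
    herm ε p.1 p.2) :=
  (hermL ε k).isBoundedBilinearMap.contDiff

variable {E : Type*} [NormedAddCommGroup E] [NormedSpace ℝ E]

theorem fderiv_herm {f g : E → Fin (k + 1) → ℂ} {x : E} (hf : DifferentiableAt ℝ f x)
    (hg : DifferentiableAt ℝ g x) (a : E) :
    fderiv ℝ (fun y => herm ε (f y) (g y)) x a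
      = herm ε (f x) (fderiv ℝ g x a) + herm ε (fderiv ℝ f x a) (g x) := by
  have := ((hermL ε k).hasFDerivAt_of_bilinear hf.hasFDerivAt hg.hasFDerivAt).fderiv
  simp only [hermL_apply] at this
  rw [this]
  rfl

/-- If `herm f g` is constant near a point, its derivative there vanishes. -/
theorem herm_fderiv_add_eq_zero {f g : E → Fin (k + 1) → ℂ} {x : E} {c : ℂ}
    (hf : DifferentiableAt ℝ f x) (hg : DifferentiableAt ℝ g x)
    (h : ∀ᶠ y in 𝓝 x, herm ε (f y) (g y) = c) (a : E) :
    herm ε (f x) (fderiv ℝ g x a) + herm ε (fderiv ℝ f x a) (g x) = 0 := by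
  rw [← fderiv_herm hf hg, Filter.EventuallyEq.fderiv_eq (f := fun _ => c) h]
  simp

/-- The horizontal projection as a complex linear map. -/
def horL (ε : ℤˣ) (z : Fin (k + 1) → ℂ) : (Fin (k + 1) → ℂ) →ₗ[ℂ] (Fin (k + 1) → ℂ) where
  toFun := horProj ε z
  map_add' v w := by
    simp only [horProj, herm_add_left, mul_add, add_smul]; abel
  map_smul' c v := by
    simp only [horProj, herm_smul_left, RingHom.id_apply, smul_sub, smul_smul]
    congr 2; ring

theorem horL_apply (z w : Fin (k + 1) → ℂ) : horL ε z w = horProj ε z w := rfl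

theorem horProj_of_herm_eq_zero {z w : Fin (k + 1) → ℂ} (h : herm ε w z = 0) :
    horProj ε z w = w := by simp [horProj, h]

theorem horProj_smul_self {z : Fin (k + 1) → ℂ} (hz : herm ε z z = ((ε : ℤ) : ℂ)) (c : ℂ) :
    horProj ε z (c • z) = 0 := by
  rw [← horL_apply, map_smul, horL_apply, horProj, hz, sign_mul_self, one_smul, sub_self, smul_zero]

theorem herm_horProj {z : Fin (k + 1) → ℂ} (hz : herm ε z z = ((ε : ℤ) : ℂ))
    (w : Fin (k + 1) → ℂ) : herm ε (horProj ε z w) z = 0 := by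
  rw [horProj, sub_eq_add_neg, herm_add_left, ← neg_smul, herm_smul_left, hz]
  linear_combination (-herm ε w z) * sign_mul_self ε

theorem horProj_circle_smul (c : Circle) (z w : Fin (k + 1) → ℂ) :
    horProj ε ((c : ℂ) • z) w = horProj ε z w := by
  have h : starRingEnd ℂ (c : ℂ) * c = 1 := by
    rw [← Complex.normSq_eq_conj_mul_self]; simp
  rw [horProj, horProj, herm_smul_right, smul_smul]
  congr 2
  linear_combination ((ε : ℤ) : ℂ) * herm ε w z * h

end Herm

/-! ### Orthonormal frames and the mean curvature -/

section Frame

variable {E V : Type*} [AddCommGroup E] [Module ℝ E] [AddCommGroup V] [Module ℝ V] {n : ℕ}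

/-- The vectors `e i` are orthonormal for the pull-back of `g` by `df`. -/
def IsFrame {ι : Type*} [DecidableEq ι] (g : V → V → ℝ) (df : E → V) (e : ι → E) : Prop :=
  ∀ i j, g (df (e i)) (df (e j)) = if i = j then 1 else 0

variable {g : V →ₗ[ℝ] V →ₗ[ℝ] ℝ} {df : E →ₗ[ℝ] V}

theorem IsFrame.expand [FiniteDimensional ℝ E] (hdim : Module.finrank ℝ E = n) {e : Fin n → E}
    (he : IsFrame (fun v w => g v w) df e) (a : E) :
    a = ∑ j, g (df a) (df (e j)) • e j := by
  have hc : ∀ (c : Fin n → ℝ) (j : Fin n), g (df (∑ i, c i • e i)) (df (e j)) = c j := by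
    intro c j
    have : ∀ i, g (df (e i)) (df (e j)) = if i = j then 1 else 0 := fun i => he i j
    simp [map_sum, this]
  have hli : LinearIndependent ℝ e := by
    rw [Fintype.linearIndependent_iff]
    intro c h j
    rw [← hc c j, h]; simp
  have hsp := hli.span_eq_top_of_card_eq_finrank' (by simp [hdim])
  have ha : a ∈ Submodule.span ℝ (Set.range e) := hsp ▸ Submodule.mem_top
  obtain ⟨c, rfl⟩ := (Submodule.mem_span_range_iff_exists_fun ℝ).1 ha
  exact Finset.sum_congr rfl fun j _ => by rw [hc c j]

/-- The trace of a bilinear map does not depend on the orthonormal frame. -/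
theorem IsFrame.trace_eq [FiniteDimensional ℝ E] (hdim : Module.finrank ℝ E = n)
    (hg : ∀ v w, g v w = g w v) {e e' : Fin n → E}
    (he : IsFrame (fun v w => g v w) df e) (he' : IsFrame (fun v w => g v w) df e')
    {W : Type*} [AddCommGroup W] [Module ℝ W] (B : E →ₗ[ℝ] E →ₗ[ℝ] W) :
    ∑ i, B (e' i) (e' i) = ∑ i, B (e i) (e i) := by
  set c : Fin n → Fin n → ℝ := fun i j => g (df (e' i)) (df (e j)) with hcdef
  have h1 : ∀ i, e' i = ∑ j, c i j • e j := fun i => he.expand hdim (e' i)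
  have h2 : ∀ j k, ∑ i, c i j * g (df (e' i)) (df (e k)) = if j = k then 1 else 0 := by
    intro j k
    have hjk := he j k
    simp only at hjk
    rw [← hjk]
    conv_rhs => rw [he'.expand hdim (e j)]
    simp only [map_sum, map_smul, LinearMap.sum_apply, LinearMap.smul_apply, smul_eq_mul, hcdef]
    exact Finset.sum_congr rfl fun i _ => by rw [hg (df (e j))]
  calc ∑ i, B (e' i) (e' i) = ∑ i, ∑ j, ∑ k, (c i j * c i k) • B (e j) (e k) := by
        refine Finset.sum_congr rfl fun i _ => ?_
        conv_lhs => rw [h1 i]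
        simp only [map_sum, map_smul, LinearMap.sum_apply, LinearMap.smul_apply, Finset.smul_sum,
          smul_smul]
        rw [Finset.sum_comm]
        exact Finset.sum_congr rfl fun j _ => Finset.sum_congr rfl fun k _ => by rw [mul_comm]
    _ = ∑ j, ∑ k, (∑ i, c i j * c i k) • B (e j) (e k) := by
        rw [Finset.sum_comm]
        refine Finset.sum_congr rfl fun j _ => ?_
        rw [Finset.sum_comm]
        exact Finset.sum_congr rfl fun k _ => by rw [Finset.sum_smul]
    _ = ∑ i, B (e i) (e i) := by
        have h3 : ∀ j k, ∑ i, c i j * c i k = if j = k then 1 else 0 := h2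
        simp [h3]

/-- A positive definite pull-back admits an orthonormal frame. -/
theorem exists_isFrame [FiniteDimensional ℝ E] (hdim : Module.finrank ℝ E = n)
    (hg : ∀ v w, g v w = g w v) (hpos : ∀ a, a ≠ 0 → 0 < g (df a) (df a)) :
    ∃ e : Fin n → E, IsFrame (fun v w => g v w) df e := by
  subst hdim
  let b : LinearMap.BilinForm ℝ E := g.compl₁₂ df df
  have hb : ∀ x y, b x y = g (df x) (df y) := fun _ _ => rfl
  obtain ⟨v, hv⟩ := LinearMap.BilinForm.exists_orthogonal_basis (B := b)
    ⟨fun x y => by simp [hb, hg (df x)]⟩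
  refine ⟨fun i => (√(b (v i) (v i)))⁻¹ • v i, fun i j => ?_⟩
  have hp := hpos (v i) (v.ne_zero i)
  simp only [map_smul, LinearMap.smul_apply, smul_eq_mul, ← hb] at hp ⊢
  split_ifs with h
  · subst h
    have := Real.mul_self_sqrt hp.le
    have h0 := (Real.sqrt_pos.2 hp).ne'
    field_simp
    rw [sq, this]
  · have : b (v i) (v j) = 0 := hv h
    simp [this]

/-- For an orthonormal frame, the mean curvature vanishes if and only if the trace of the second
derivative is tangent. For `n = 0` both sides hold. -/
theorem IsFrame.meanCurvature_eq_zero_iff [FiniteDimensional ℝ E] (hdim : Module.finrank ℝ E = n)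
    {e : Fin n → E} (he : IsFrame (fun v w => g v w) df e) (B : E → E → V) :
    meanCurvature (fun v w => g v w) df B e = 0 ↔ ∃ a, ∑ i, B (e i) (e i) = df a := by
  have hsum : ∑ i, normalPart (fun v w => g v w) df e (B (e i) (e i))
      = ∑ i, B (e i) (e i) - ∑ j, g (∑ i, B (e i) (e i)) (df (e j)) • df (e j) := by
    simp only [normalPart, Finset.sum_sub_distrib, map_sum, LinearMap.sum_apply, Finset.sum_smul]
    rw [Finset.sum_comm]
  rw [meanCurvature, hsum]
  constructor
  · intro h
    rcases Nat.eq_zero_or_pos n with rfl | hn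
    · exact ⟨0, by simp⟩
    · have hn' : (1 / (n : ℝ)) ≠ 0 := by positivity
      have h' := sub_eq_zero.1 ((smul_eq_zero.1 h).resolve_left hn')
      refine ⟨∑ j, g (∑ i, B (e i) (e i)) (df (e j)) • e j, ?_⟩
      rw [map_sum]
      simpa only [map_smul] using h'
  · rintro ⟨a, ha⟩
    rw [ha]
    conv_lhs => enter [2, 1]; rw [he.expand hdim a]
    simp

end Frame

/-! ### Horizontal lifts and change of lift -/

section Lift

variable {ε : ℤˣ} {k : ℕ} {E : Type*} [NormedAddCommGroup E] [NormedSpace ℝ E]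
  {u v w : E → Fin (k + 1) → ℂ} {y : E}

theorem contDiffAt_herm {n : WithTop ℕ∞} (hn : n ≤ ∞) (hu : ContDiffAt ℝ n u y)
    (hv : ContDiffAt ℝ n v y) :
    ContDiffAt ℝ n (fun x => herm ε (u x) (v x)) y :=
  (contDiff_herm.of_le hn).contDiffAt.comp y (hu.prodMk hv)

theorem two_le_infty : (2 : WithTop ℕ∞) ≤ ∞ := WithTop.coe_le_coe.2 le_top

theorem contDiffAt_fderiv_apply {F : Type*} [NormedAddCommGroup F] [NormedSpace ℝ F]
    {u : E → F} (hu : ContDiffAt ℝ 2 u y) (b : E) :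
    ContDiffAt ℝ 1 (fun x => fderiv ℝ u x b) y :=
  (hu.fderiv_right (m := 1) (by norm_num)).clm_apply contDiffAt_const

theorem fderiv_fderiv_apply {F : Type*} [NormedAddCommGroup F] [NormedSpace ℝ F]
    {u : E → F} (hu : ContDiffAt ℝ 2 u y) (a b : E) :
    fderiv ℝ (fun x => fderiv ℝ u x b) y a = fderiv ℝ (fderiv ℝ u) y a b := by
  have h : DifferentiableAt ℝ (fderiv ℝ u) y :=
    (hu.fderiv_right (m := 1) (by norm_num)).differentiableAt one_ne_zero
  rw [fderiv_clm_apply h (differentiableAt_const b)]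
  simp

theorem dHor_of_horizontal {x : E} (h : ∀ a, herm ε (fderiv ℝ u x a) (u x) = 0) (a : E) :
    dHor ε u x a = fderiv ℝ u x a := horProj_of_herm_eq_zero (h a)

/-- For a horizontal lift the Levi-Civita derivative is the horizontal part of the second
derivative. -/
theorem covHor_of_horizontal (hu : ContDiffAt ℝ 2 u y)
    (h : ∀ᶠ x in 𝓝 y, ∀ a, herm ε (fderiv ℝ u x a) (u x) = 0) (a b : E) :
    covHor ε u y a b = horProj ε (u y) (fderiv ℝ (fderiv ℝ u) y a b) := by
  have h1 : (fun x => dHor ε u x b) =ᶠ[𝓝 y] fun x => fderiv ℝ u x b :=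
    h.mono fun x hx => dHor_of_horizontal hx b
  rw [covHor, h1.fderiv_eq, fderiv_fderiv_apply hu, h.self_of_nhds a]
  simp

/-- Differentiating `(Du b, v) = 0` gives `(D²u(a, b), v) = -(Du b, Dv a)`. -/
theorem herm_fderiv_fderiv (hu : ContDiffAt ℝ 2 u y) (hv : DifferentiableAt ℝ v y) {b : E}
    (h : ∀ᶠ x in 𝓝 y, herm ε (fderiv ℝ u x b) (v x) = 0) (a : E) :
    herm ε (fderiv ℝ (fderiv ℝ u) y a b) (v y)
      = -herm ε (fderiv ℝ u y b) (fderiv ℝ v y a) := by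
  have := herm_fderiv_add_eq_zero
    ((contDiffAt_fderiv_apply hu b).differentiableAt one_ne_zero) hv h a
  rw [fderiv_fderiv_apply hu] at this
  linear_combination this

/-- Multiplying the lift by a circle-valued function multiplies the horizontal vectors that
represent the differential and its covariant derivative by that function. -/
theorem dHor_covHor_gauge (hv : ContDiffAt ℝ 2 v y) (hw : ContDiffAt ℝ 2 w y)
    (hq : ∀ᶠ x in 𝓝 y, herm ε (v x) (v x) = ((ε : ℤ) : ℂ))
    (hc : ∀ᶠ x in 𝓝 y, ∃ c : Circle, w x = (c : ℂ) • v x) :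
    ∃ c : Circle, (∀ a, dHor ε w y a = (c : ℂ) • dHor ε v y a)
      ∧ ∀ a b, covHor ε w y a b = (c : ℂ) • covHor ε v y a b := by
  -- the circle-valued factor is smooth, as it can be read off from the Hermitian form
  set c : E → ℂ := fun x => ((ε : ℤ) : ℂ) * herm ε (w x) (v x) with hcdef
  have hcd : ContDiffAt ℝ 2 c y := contDiffAt_const.mul (contDiffAt_herm two_le_infty hw hv)
  have hcw : ∀ᶠ x in 𝓝 y, ∃ d : Circle, c x = d ∧ w x = c x • v x := by
    filter_upwards [hq, hc] with x hx ⟨d, hd⟩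
    have : c x = d := by
      rw [hcdef]
      simp only [hd, herm_smul_left, hx]
      linear_combination (d : ℂ) * sign_mul_self ε
    exact ⟨d, this, by rw [this, hd]⟩
  have hdiff : ∀ᶠ x in 𝓝 y, DifferentiableAt ℝ v x ∧ DifferentiableAt ℝ c x :=
    ((hv.eventually (by simp)).and (hcd.eventually (by simp))).mono fun x hx =>
      ⟨hx.1.differentiableAt two_ne_zero, hx.2.differentiableAt two_ne_zero⟩
  have hfd : ∀ᶠ x in 𝓝 y, ∀ a, fderiv ℝ w x a = c x • fderiv ℝ v x a + fderiv ℝ c x a • v x := by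
    filter_upwards [hdiff, hcw.eventually_nhds] with x hx hx' a
    have : w =ᶠ[𝓝 x] fun x => c x • v x := hx'.mono fun z hz => hz.choose_spec.2
    rw [this.fderiv_eq, fderiv_fun_smul hx.2 hx.1]
    simp
  have hdH : ∀ᶠ x in 𝓝 y, ∀ a, dHor ε w x a = c x • dHor ε v x a := by
    filter_upwards [hfd, hcw, hq] with x h1 h2 h3 a
    obtain ⟨d, hd, h2⟩ := h2
    rw [dHor, dHor, h1, h2, hd, horProj_circle_smul, ← horL_apply, map_add, map_smul, horL_apply,
      horL_apply, horProj_smul_self h3, add_zero]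
  obtain ⟨d, hd, hwd⟩ := hcw.self_of_nhds
  have hqy := hq.self_of_nhds
  refine ⟨d, fun a => by rw [hdH.self_of_nhds a, hd], fun a b => ?_⟩
  have h1 : (fun x => dHor ε w x b) =ᶠ[𝓝 y] fun x => c x • dHor ε v x b := hdH.mono fun x hx => hx b
  have hdv : DifferentiableAt ℝ (fun x => dHor ε v x b) y := by
    have hvb := contDiffAt_fderiv_apply hv b
    have hv1 : ContDiffAt ℝ 1 v y := hv.of_le (by norm_num)
    have : ContDiffAt ℝ 1 (fun x => dHor ε v x b) y :=
      hvb.sub ((contDiffAt_const.mul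
        (contDiffAt_herm (by exact_mod_cast le_top) hvb hv1)).smul hv1)
    exact this.differentiableAt one_ne_zero
  have hor : horProj ε (v y) (dHor ε v y b) = dHor ε v y b :=
    horProj_of_herm_eq_zero (herm_horProj hqy _)
  have hdd : starRingEnd ℂ (d : ℂ) * d = 1 := by
    rw [← Complex.normSq_eq_conj_mul_self]; simp
  rw [covHor, covHor, h1.fderiv_eq, fderiv_fun_smul hdiff.self_of_nhds.2 hdv, hfd.self_of_nhds a,
    hdH.self_of_nhds b, hwd, hd, horProj_circle_smul]
  simp only [add_apply, smul_apply,
    ContinuousLinearMap.smulRight_apply]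
  rw [← horL_apply, map_add, map_smul, map_smul, horL_apply, horL_apply, hor, herm_add_left,
    herm_smul_left, herm_smul_left, herm_smul_right, herm_smul_right, hqy, smul_sub, smul_smul,
    smul_smul]
  have hcoef : ((ε : ℤ) : ℂ) * (d * (starRingEnd ℂ (d : ℂ) * herm ε (fderiv ℝ v y a) (v y))
      + fderiv ℝ c y a * (starRingEnd ℂ (d : ℂ) * ((ε : ℤ) : ℂ))) * d
      = d * (((ε : ℤ) : ℂ) * herm ε (fderiv ℝ v y a) (v y)) + fderiv ℝ c y a := by
    linear_combination (((ε : ℤ) : ℂ) * herm ε (fderiv ℝ v y a) (v y) * d + fderiv ℝ c y a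
      * (((ε : ℤ) : ℂ) * ((ε : ℤ) : ℂ))) * hdd + fderiv ℝ c y a * sign_mul_self ε
  rw [hcoef, add_smul]
  abel

/-- The pointwise condition does not depend on the lift. -/
theorem MinLagAt.gauge {n : ℕ} (hv : ContDiffAt ℝ 2 v y) (hw : ContDiffAt ℝ 2 w y)
    (hq : ∀ᶠ x in 𝓝 y, herm ε (v x) (v x) = ((ε : ℤ) : ℂ))
    (hc : ∀ᶠ x in 𝓝 y, ∃ c : Circle, w x = (c : ℂ) • v x)
    (h : MinLagAt n (reHerm ε) (dHor ε v y) (covHor ε v y)) :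
    MinLagAt n (reHerm ε) (dHor ε w y) (covHor ε w y) := by
  obtain ⟨c, h1, h2⟩ := dHor_covHor_gauge hv hw hq hc
  have hcc : (c : ℂ) * starRingEnd ℂ (c : ℂ) = 1 := by
    rw [Complex.mul_conj]; simp
  have hre : ∀ a b : Fin (k + 1) → ℂ, reHerm ε ((c : ℂ) • a) ((c : ℂ) • b) = reHerm ε a b := by
    intro a b
    rw [reHerm, reHerm, herm_smul_left, herm_smul_right, ← mul_assoc, hcc, one_mul]
  refine ⟨h.dim, fun a b hab => h.immersion ?_, fun a b => ?_, fun e he => ?_⟩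
  · simp only [h1] at hab
    exact smul_right_injective _ c.coe_ne_zero hab
  · rw [h1, h1, smul_comm, hre, h.lagrangian]
  · have hm := h.minimal e (fun i j => by rw [← he i j, h1, h1, hre])
    have : meanCurvature (reHerm ε) (dHor ε w y) (covHor ε w y) e
        = (c : ℂ) • meanCurvature (reHerm ε) (dHor ε v y) (covHor ε v y) e := by
      simp only [meanCurvature, normalPart, h1, h2, hre, smul_comm _ (c : ℂ), ← Finset.smul_sum,
        ← smul_sub]
    rw [this, hm, smul_zero]

end Lift

/-! ### Cones -/

section Cone

variable {E : Type*} [NormedAddCommGroup E] [NormedSpace ℝ E]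

section Derivatives

variable {V : Type*} [NormedAddCommGroup V] [NormedSpace ℝ V]
  {a a₁ : ℝ → ℝ} {κ κ₁ : ℝ → V} {W : E → V}

/-- The map `(t, x) ↦ a(t) W(x) + κ(t)`. -/
def cone (a : ℝ → ℝ) (κ : ℝ → V) (W : E → V) (q : ℝ × E) : V := a q.1 • W q.2 + κ q.1

theorem fderiv_cone {q : ℝ × E} (ha : HasDerivAt a (a₁ q.1) q.1) (hκ : HasDerivAt κ (κ₁ q.1) q.1)
    (hW : DifferentiableAt ℝ W q.2) (p : ℝ × E) :
    fderiv ℝ (cone a κ W) q p = p.1 • cone a₁ κ₁ W q + a q.1 • fderiv ℝ W q.2 p.2 := by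
  have h1 : HasFDerivAt (fun q : ℝ × E => a q.1) _ q := ha.hasFDerivAt.comp q hasFDerivAt_fst
  have h2 : HasFDerivAt (fun q : ℝ × E => κ q.1) _ q := hκ.hasFDerivAt.comp q hasFDerivAt_fst
  have h3 : HasFDerivAt (fun q : ℝ × E => W q.2) _ q := hW.hasFDerivAt.comp q hasFDerivAt_snd
  have h := (h1.smul h3).add h2
  have h' : HasFDerivAt (cone a κ W) _ q := h
  rw [h'.fderiv]
  simp only [cone, add_apply, smul_apply, ContinuousLinearMap.smulRight_apply,
    ContinuousLinearMap.comp_apply, ContinuousLinearMap.coe_fst', ContinuousLinearMap.coe_snd',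
    ContinuousLinearMap.toSpanSingleton_apply, smul_add, smul_smul, smul_eq_mul]
  abel

theorem contDiffAt_cone {n : WithTop ℕ∞} {q : ℝ × E} (ha : ContDiff ℝ n a) (hκ : ContDiff ℝ n κ)
    (hW : ContDiffAt ℝ n W q.2) : ContDiffAt ℝ n (cone a κ W) q :=
  ((ha.contDiffAt.comp q contDiffAt_fst).smul (hW.comp q contDiffAt_snd)).add
    (hκ.contDiffAt.comp q contDiffAt_fst)

theorem contDiff_two_of_hasDerivAt (ha : ∀ t, HasDerivAt κ (κ₁ t) t)
    (ha₁ : ∀ t, HasDerivAt κ₁ (κ t) t) : ContDiff ℝ 2 κ := by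
  have h1 : deriv κ = κ₁ := funext fun t => (ha t).deriv
  have h2 : deriv κ₁ = κ := funext fun t => (ha₁ t).deriv
  have hc : ContDiff ℝ 1 κ₁ := by
    rw [contDiff_one_iff_deriv, h2]
    exact ⟨fun t => (ha₁ t).differentiableAt,
      continuous_iff_continuousAt.2 fun t => (ha t).continuousAt⟩
  rw [show (2 : WithTop ℕ∞) = 1 + 1 by norm_num, contDiff_succ_iff_deriv, h1]
  exact ⟨fun t => (ha t).differentiableAt, by simp, hc⟩

/-- The second derivative of a cone whose profile functions solve `a'' = a` and `κ'' = κ`. -/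
theorem fderiv_fderiv_cone {q : ℝ × E} (ha : ∀ t, HasDerivAt a (a₁ t) t)
    (ha₁ : ∀ t, HasDerivAt a₁ (a t) t) (hκ : ∀ t, HasDerivAt κ (κ₁ t) t)
    (hκ₁ : ∀ t, HasDerivAt κ₁ (κ t) t) (hW : ContDiffAt ℝ 2 W q.2) (p p' : ℝ × E) :
    fderiv ℝ (fderiv ℝ (cone a κ W)) q p p' = (p.1 * p'.1) • cone a κ W q
      + a₁ q.1 • (p'.1 • fderiv ℝ W q.2 p.2 + p.1 • fderiv ℝ W q.2 p'.2)
      + a q.1 • fderiv ℝ (fderiv ℝ W) q.2 p.2 p'.2 := by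
  have hc : ContDiffAt ℝ 2 (cone a κ W) q :=
    contDiffAt_cone (contDiff_two_of_hasDerivAt ha ha₁) (contDiff_two_of_hasDerivAt hκ hκ₁) hW
  rw [← fderiv_fderiv_apply hc]
  have hWd : ∀ᶠ x : ℝ × E in 𝓝 q, DifferentiableAt ℝ W x.2 :=
    continuousAt_snd.eventually
      ((hW.eventually (by simp)).mono fun x hx => hx.differentiableAt two_ne_zero)
  have h1 : (fun x => fderiv ℝ (cone a κ W) x p') =ᶠ[𝓝 q]
      fun x => p'.1 • cone a₁ κ₁ W x + cone a (fun _ => 0) (fun x => fderiv ℝ W x p'.2) x := by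
    filter_upwards [hWd] with x hx
    rw [fderiv_cone (ha _) (hκ _) hx]
    simp [cone]
  have hW1 := hW.differentiableAt two_ne_zero
  have hW2 : DifferentiableAt ℝ (fun x => fderiv ℝ W x p'.2) q.2 :=
    (contDiffAt_fderiv_apply hW p'.2).differentiableAt one_ne_zero
  have hd1 : DifferentiableAt ℝ (cone a₁ κ₁ W) q :=
    (contDiffAt_cone (contDiff_two_of_hasDerivAt ha₁ ha) (contDiff_two_of_hasDerivAt hκ₁ hκ)
      hW).differentiableAt two_ne_zero
  have hd2 : DifferentiableAt ℝ (cone a (fun _ => 0) (fun x => fderiv ℝ W x p'.2)) q :=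
    (contDiffAt_cone ((contDiff_two_of_hasDerivAt ha ha₁).of_le (by norm_num)) contDiff_const
      (contDiffAt_fderiv_apply hW p'.2)).differentiableAt one_ne_zero
  rw [h1.fderiv_eq, fderiv_fun_add (hd1.fun_const_smul _) hd2, fderiv_fun_const_smul hd1, add_apply,
    smul_apply, fderiv_cone (ha₁ _) (hκ₁ _) hW1,
    fderiv_cone (κ₁ := fun _ => 0) (ha _) (hasDerivAt_const _ _) hW2, fderiv_fderiv_apply hW]
  simp only [cone]
  module

end Derivatives

variable {m : ℕ} {a a₁ : ℝ → ℝ} {κ κ₁ : ℝ → Fin (m + 2) → ℂ} {W : E → Fin (m + 2) → ℂ}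

/-- A criterion for the cone `(t, x) ↦ [a(t) W(x) + κ(t)]` to be a minimal Lagrangian immersion in
complex hyperbolic space. The lift is horizontal, the curves `t ↦ [a(t) W(x) + κ(t)]` are
geodesics because `a'' = a` and `κ'' = κ`, and the metric is `dt² + a² h`, with `h` the pull-back
of the Hermitian form by `W`. Hence only the trace of `D²W` contributes to the mean curvature. By
`hmin` it is tangent up to a complex multiple of a vector `Z` in the real span of the position
vector and of its `t`-derivative; horizontality forces that multiple to be real. -/
theorem minLagAt_cone [FiniteDimensional ℝ E] (hdim : Module.finrank ℝ E = m) {s : ℝ} {y : E}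
    (ha : ∀ t, HasDerivAt a (a₁ t) t) (ha₁ : ∀ t, HasDerivAt a₁ (a t) t)
    (hκ : ∀ t, HasDerivAt κ (κ₁ t) t) (hκ₁ : ∀ t, HasDerivAt κ₁ (κ t) t)
    (has : a s ≠ 0) (hW : ContDiffAt ℝ 2 W y)
    (hq : ∀ᶠ x in 𝓝 y, ∀ t, herm (-1) (cone a κ W (t, x)) (cone a κ W (t, x)) = -1)
    (hht : ∀ᶠ x in 𝓝 y, ∀ t, herm (-1) (cone a₁ κ₁ W (t, x)) (cone a κ W (t, x)) = 0)
    (hhx : ∀ᶠ x in 𝓝 y, ∀ t e, herm (-1) (fderiv ℝ W x e) (cone a κ W (t, x)) = 0)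
    (hpos : ∀ e, e ≠ 0 → 0 < reHerm (-1) (fderiv ℝ W y e) (fderiv ℝ W y e))
    (hlag : ∀ e e', (herm (-1) (fderiv ℝ W y e) (fderiv ℝ W y e')).im = 0)
    {Z : Fin (m + 2) → ℂ} {r r' : ℝ} (hr' : r' ≠ 0)
    (hZ : Z = r • cone a₁ κ₁ W (s, y) + r' • cone a κ W (s, y))
    (hmin : ∀ e : Fin m → E, IsFrame (reHerm (-1)) (fderiv ℝ W y) e →
      ∃ (v : E) (c : ℂ), ∑ i, fderiv ℝ (fderiv ℝ W) y (e i) (e i) = fderiv ℝ W y v + c • Z) :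
    MinLagAt (m + 1) (reHerm (-1)) (dHor (-1) (cone a κ W) (s, y))
      (covHor (-1) (cone a κ W) (s, y)) := by
  set u := cone a κ W with hu
  have hau := contDiff_two_of_hasDerivAt ha ha₁
  have hκu := contDiff_two_of_hasDerivAt hκ hκ₁
  have hucd : ContDiffAt ℝ 2 u (s, y) := contDiffAt_cone hau hκu hW
  have hW1 := hW.differentiableAt two_ne_zero
  have hWd : ∀ᶠ x in 𝓝 y, DifferentiableAt ℝ W x :=
    (hW.eventually (by simp)).mono fun x hx => hx.differentiableAt two_ne_zero
  -- the lift is horizontal near the point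
  have hhor : ∀ᶠ q in 𝓝 (s, y), ∀ p, herm (-1) (fderiv ℝ u q p) (u q) = 0 := by
    have hsnd : Tendsto (Prod.snd : ℝ × E → E) (𝓝 (s, y)) (𝓝 y) := continuousAt_snd
    filter_upwards [hsnd.eventually hht, hsnd.eventually hhx, hsnd.eventually hWd]
      with q h1 h2 h3 p
    rw [hu, fderiv_cone (ha _) (hκ _) h3, herm_add_left, herm_real_smul_left, herm_real_smul_left,
      h1 q.1, h2 q.1, mul_zero, mul_zero, add_zero]
  have hqy : herm (-1) (u (s, y)) (u (s, y)) = (((-1 : ℤˣ) : ℤ) : ℂ) := by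
    rw [hq.self_of_nhds s]; simp
  have hdu : ∀ p, fderiv ℝ u (s, y) p
      = p.1 • cone a₁ κ₁ W (s, y) + a s • fderiv ℝ W y p.2 := fun p =>
    fderiv_cone (ha _) (hκ _) hW1 p
  -- derivatives of horizontality in the direction of `t`
  have hcd : ∀ t, HasDerivAt (fun t => u (t, y)) (cone a₁ κ₁ W (t, y)) t := fun t =>
    ((ha t).smul_const (W y)).add (hκ t)
  have hcd₁ : ∀ t, HasDerivAt (fun t => cone a₁ κ₁ W (t, y)) (u (t, y)) t := fun t =>
    ((ha₁ t).smul_const (W y)).add (hκ₁ t)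
  have htt : herm (-1) (cone a₁ κ₁ W (s, y)) (cone a₁ κ₁ W (s, y)) = 1 := by
    have := herm_fderiv_add_eq_zero (hcd₁ s).differentiableAt (hcd s).differentiableAt
      (.of_forall hht.self_of_nhds) 1
    rw [(hcd s).hasFDerivAt.fderiv, (hcd₁ s).hasFDerivAt.fderiv] at this
    simp only [ContinuousLinearMap.toSpanSingleton_apply, one_smul, hq.self_of_nhds s] at this
    linear_combination this
  have hxt : ∀ e, herm (-1) (fderiv ℝ W y e) (cone a₁ κ₁ W (s, y)) = 0 := by
    intro e
    have := herm_fderiv_add_eq_zero (f := fun _ => fderiv ℝ W y e) (differentiableAt_const _)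
      (hcd s).differentiableAt (.of_forall fun t => hhx.self_of_nhds t e) 1
    rw [(hcd s).hasFDerivAt.fderiv] at this
    simpa [herm_zero_left] using this
  have htx : ∀ e, herm (-1) (cone a₁ κ₁ W (s, y)) (fderiv ℝ W y e) = 0 := by
    intro e
    rw [← conj_herm, hxt, map_zero]
  have hmetric : ∀ p p', herm (-1) (fderiv ℝ u (s, y) p) (fderiv ℝ u (s, y) p')
      = p.1 * p'.1 + a s ^ 2 * herm (-1) (fderiv ℝ W y p.2) (fderiv ℝ W y p'.2) := by
    intro p p'
    simp only [hdu, herm_add_left, herm_add_right, herm_real_smul_left, herm_real_smul_right, htt,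
      hxt, htx]
    ring
  have hremetric : ∀ p p', reHerm (-1) (fderiv ℝ u (s, y) p) (fderiv ℝ u (s, y) p')
      = p.1 * p'.1 + a s ^ 2 * reHerm (-1) (fderiv ℝ W y p.2) (fderiv ℝ W y p'.2) := by
    intro p p'
    have := congrArg Complex.re (hmetric p p')
    rw [reHerm, this, ← Complex.ofReal_pow, ← Complex.ofReal_mul, Complex.add_re,
      Complex.ofReal_re, Complex.re_ofReal_mul, reHerm]
  have hdim' : Module.finrank ℝ (ℝ × E) = m + 1 := by
    rw [Module.finrank_prod, hdim, Module.finrank_self, add_comm]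
  have hdH : dHor (-1) u (s, y) = (fderiv ℝ u (s, y) : ℝ × E →ₗ[ℝ] Fin (m + 2) → ℂ) :=
    funext fun p => dHor_of_horizontal hhor.self_of_nhds p
  refine ⟨hdim', ?_, fun p p' => ?_, fun f hf => ?_⟩
  · rw [hdH, ← LinearMap.ker_eq_bot, LinearMap.ker_eq_bot']
    intro p hp
    have h0 := hremetric p p
    rw [show fderiv ℝ u (s, y) p = 0 from hp,
      show reHerm (-1) (0 : Fin (m + 2) → ℂ) 0 = 0 by simp [reHerm, herm_zero_left]] at h0
    by_contra hne
    by_cases h2 : p.2 = 0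
    · have h1 : p.1 ≠ 0 := fun h1 => hne (Prod.ext h1 h2)
      rw [h2, map_zero,
        show reHerm (-1) (0 : Fin (m + 2) → ℂ) 0 = 0 by simp [reHerm, herm_zero_left]] at h0
      simp [h1] at h0
    · have := mul_pos (sq_pos_of_ne_zero has) (hpos p.2 h2)
      nlinarith [mul_self_nonneg p.1]
  · rw [hdH, reHerm_I_smul_left]
    have := congrArg Complex.im (hmetric p p')
    rw [← Complex.ofReal_pow, ← Complex.ofReal_mul, Complex.add_im, Complex.ofReal_im,
      Complex.im_ofReal_mul, hlag, mul_zero, add_zero] at this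
    exact neg_eq_zero.2 this
  · rw [hdH] at hf ⊢
    obtain ⟨e, he⟩ := exists_isFrame (g := reHermL (-1) (m + 1))
      (df := (fderiv ℝ W y : E →ₗ[ℝ] Fin (m + 2) → ℂ)) hdim reHerm_comm hpos
    have he' : ∀ i j, reHerm (-1) (fderiv ℝ W y (e i)) (fderiv ℝ W y (e j))
        = if i = j then 1 else 0 := he
    -- an orthonormal frame adapted to the product
    let f₀ : Fin (m + 1) → ℝ × E :=
      Fin.cons (α := fun _ => ℝ × E) (1, 0) fun i => (0, (a s)⁻¹ • e i)
    have hz0 : ∀ v : Fin (m + 2) → ℂ, reHerm (-1) v 0 = 0 := fun v => (reHermL _ _ v).map_zero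
    have h0z : ∀ v : Fin (m + 2) → ℂ, reHerm (-1) 0 v = 0 := fun v => by
      rw [reHerm_comm, hz0]
    have hre : ∀ (t : ℝ) (v v' : Fin (m + 2) → ℂ),
        reHerm (-1) (t • v) (t • v') = t ^ 2 * reHerm (-1) v v' := by
      intro t v v'
      rw [reHerm, herm_real_smul_left, herm_real_smul_right, Complex.re_ofReal_mul,
        Complex.re_ofReal_mul, ← mul_assoc, ← sq, reHerm]
    have hf₀ : IsFrame (fun v w => reHermL (-1) (m + 1) v w)
        (fderiv ℝ u (s, y) : ℝ × E →ₗ[ℝ] Fin (m + 2) → ℂ) f₀ := by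
      intro i j
      change reHerm (-1) (fderiv ℝ u (s, y) (f₀ i)) (fderiv ℝ u (s, y) (f₀ j)) = _
      rw [hremetric]
      refine Fin.cases ?_ (fun i => ?_) i <;> refine Fin.cases ?_ (fun j => ?_) j
      · simp [f₀, hz0]
      · simp [f₀, h0z, (Fin.succ_ne_zero j).symm]
      · simp [f₀, hz0, Fin.succ_ne_zero i]
      · simp only [f₀, Fin.cons_succ, map_smul, hre, he', mul_zero, zero_add, Fin.succ_inj]
        split_ifs <;> field_simp
    have hf' : IsFrame (fun v w => reHermL (-1) (m + 1) v w)
        (fderiv ℝ u (s, y) : ℝ × E →ₗ[ℝ] Fin (m + 2) → ℂ) f := hf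
    refine (hf'.meanCurvature_eq_zero_iff hdim' _).2 ?_
    have htrace := hf₀.trace_eq hdim' reHerm_comm hf'
      ((ContinuousLinearMap.coeLM ℝ).comp (fderiv ℝ (fderiv ℝ u) (s, y)).toLinearMap)
    have htrace' : ∑ i, fderiv ℝ (fderiv ℝ u) (s, y) (f i) (f i)
        = ∑ i, fderiv ℝ (fderiv ℝ u) (s, y) (f₀ i) (f₀ i) := htrace
    have hcov : ∑ i, covHor (-1) u (s, y) (f i) (f i)
        = horL (-1) (u (s, y)) (∑ i, fderiv ℝ (fderiv ℝ u) (s, y) (f₀ i) (f₀ i)) := by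
      rw [← htrace', map_sum]
      exact Finset.sum_congr rfl fun i _ => covHor_of_horizontal hucd hhor _ _
    obtain ⟨v, c, hvc⟩ := hmin e he
    -- the multiple of `Z` is real
    have hc : c.im = 0 := by
      have h1 : ∀ i, (herm (-1) (fderiv ℝ (fderiv ℝ W) y (e i) (e i)) (u (s, y))).im = 0 := by
        intro i
        have hus : DifferentiableAt ℝ (fun x => u (s, x)) y := by
          exact (hucd.differentiableAt two_ne_zero).comp y
            ((differentiableAt_const s).prodMk differentiableAt_id)
        have hfs : fderiv ℝ (fun x => u (s, x)) y (e i) = a s • fderiv ℝ W y (e i) := by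
          have : (fun x => u (s, x)) = fun x => a s • W x + κ s := rfl
          rw [this, fderiv_add_const, fderiv_fun_const_smul hW1]; rfl
        rw [herm_fderiv_fderiv (v := fun x => u (s, x)) hW hus (hhx.mono fun x hx => hx s (e i)),
          hfs, herm_real_smul_right, Complex.neg_im, Complex.im_ofReal_mul, hlag]
        simp
      have h2 : (herm (-1) (∑ i, fderiv ℝ (fderiv ℝ W) y (e i) (e i)) (u (s, y))).im = 0 := by
        rw [← hermL_apply, map_sum, sum_apply, Complex.im_sum]
        exact Finset.sum_eq_zero fun i _ => h1 i
      rw [hvc, hZ, herm_add_left, herm_smul_left, herm_add_left, herm_real_smul_left,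
        herm_real_smul_left, hht.self_of_nhds s, hhx.self_of_nhds s, hq.self_of_nhds s] at h2
      simpa [hr'] using h2
    obtain ⟨c, rfl⟩ : ∃ x : ℝ, c = x := ⟨c.re, Complex.ext rfl (by simpa using hc)⟩
    have hsum : ∑ i, fderiv ℝ (fderiv ℝ u) (s, y) (f₀ i) (f₀ i)
        = fderiv ℝ u (s, y) ((a s)⁻¹ * c * r, ((a s)⁻¹ * (a s)⁻¹) • v)
          + ((1 + (a s)⁻¹ * c * r' : ℝ) : ℂ) • u (s, y) := by
      have hi : ∀ i, fderiv ℝ (fderiv ℝ u) (s, y) (f₀ (Fin.succ i)) (f₀ (Fin.succ i))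
          = (a s)⁻¹ • fderiv ℝ (fderiv ℝ W) y (e i) (e i) := by
        intro i
        rw [hu, fderiv_fderiv_cone ha ha₁ hκ hκ₁ hW]
        simp only [f₀, Fin.cons_succ, map_smul, smul_apply, smul_smul, mul_zero, zero_mul,
          zero_smul, zero_add, smul_zero]
        congr 1
        field_simp
      rw [Fin.sum_univ_succ, Finset.sum_congr rfl fun i _ => hi i, ← Finset.smul_sum, hvc, hdu, hZ,
        hu, fderiv_fderiv_cone ha ha₁ hκ hκ₁ hW, Complex.coe_smul, Complex.coe_smul]
      simp only [f₀, Fin.cons_zero, mul_one, one_smul, map_zero, smul_zero, add_zero,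
        map_smul, smul_smul]
      rw [← mul_assoc (a s), mul_inv_cancel₀ has, one_mul]
      module
    rw [hcov, hsum, map_add, horL_apply, horL_apply, horProj_smul_self hqy, add_zero,
      horProj_of_herm_eq_zero (hhor.self_of_nhds _)]
    exact ⟨_, rfl⟩

end Cone

/-! ### Totally geodesic joins and the horospherical cone -/

section LinearImage

variable {E V V' : Type*} [NormedAddCommGroup E] [NormedSpace ℝ E] [NormedAddCommGroup V]
  [NormedSpace ℝ V] [NormedAddCommGroup V'] [NormedSpace ℝ V'] {v : E → V} {y : E}

theorem fderiv_clm_comp (L : V →L[ℝ] V') {x : E} (hv : DifferentiableAt ℝ v x) (a : E) :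
    fderiv ℝ (fun x => L (v x)) x a = L (fderiv ℝ v x a) := by
  have : HasFDerivAt (fun x => L (v x)) _ x := L.hasFDerivAt.comp x hv.hasFDerivAt
  rw [this.fderiv]; rfl

theorem fderiv_fderiv_clm_comp (L : V →L[ℝ] V') (hv : ContDiffAt ℝ 2 v y) (a b : E) :
    fderiv ℝ (fderiv ℝ fun x => L (v x)) y a b = L (fderiv ℝ (fderiv ℝ v) y a b) := by
  have hLv : ContDiffAt ℝ 2 (fun x => L (v x)) y := L.contDiff.contDiffAt.comp y hv
  have h1 : (fun x => fderiv ℝ (fun x => L (v x)) x b) =ᶠ[𝓝 y] fun x => L (fderiv ℝ v x b) :=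
    (hv.eventually (by simp)).mono fun x hx =>
      fderiv_clm_comp L (hx.differentiableAt two_ne_zero) b
  rw [← fderiv_fderiv_apply hLv, h1.fderiv_eq,
    fderiv_clm_comp L ((contDiffAt_fderiv_apply hv b).differentiableAt one_ne_zero),
    fderiv_fderiv_apply hv]

end LinearImage

section HorizontalData

variable {ε : ℤˣ} {k : ℕ} {E : Type*} [NormedAddCommGroup E] [NormedSpace ℝ E]
  {v : E → Fin (k + 1) → ℂ} {y : E}

/-- What a horizontal lift `v` of a minimal Lagrangian immersion satisfies: positivity of the
metric, vanishing of the imaginary part of the pulled back Hermitian form, and tangency of the trace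
of the second derivative up to a multiple of `v`. -/
theorem MinLagAt.horizontal {n : ℕ} [FiniteDimensional ℝ E]
    (h : MinLagAt n (reHerm ε) (dHor ε v y) (covHor ε v y)) (hv : ContDiffAt ℝ 2 v y)
    (hq : herm ε (v y) (v y) = ((ε : ℤ) : ℂ))
    (hh : ∀ᶠ x in 𝓝 y, ∀ a, herm ε (fderiv ℝ v x a) (v x) = 0) :
    (∀ a, a ≠ 0 → 0 < reHerm ε (fderiv ℝ v y a) (fderiv ℝ v y a)) ∧
    (∀ a b, (herm ε (fderiv ℝ v y a) (fderiv ℝ v y b)).im = 0) ∧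
    ∀ e : Fin n → E, IsFrame (reHerm ε) (fderiv ℝ v y) e → ∃ (w : E) (c : ℂ),
      ∑ i, fderiv ℝ (fderiv ℝ v) y (e i) (e i) = fderiv ℝ v y w + c • v y := by
  have hdH : dHor ε v y = (fderiv ℝ v y : E →ₗ[ℝ] Fin (k + 1) → ℂ) :=
    funext fun p => dHor_of_horizontal hh.self_of_nhds p
  obtain ⟨hdim, himm, hlag, hmin⟩ := h
  rw [hdH] at himm hlag hmin
  refine ⟨fun a ha => reHerm_self_pos hq (hh.self_of_nhds a) fun h0 => ha ?_, fun a b => ?_,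
    fun e he => ?_⟩
  · exact himm (h0.trans (map_zero (fderiv ℝ v y)).symm)
  · have := hlag a b
    rw [reHerm_I_smul_left] at this
    exact neg_eq_zero.1 this
  · have he' : IsFrame (fun v w => reHermL ε k v w)
        (fderiv ℝ v y : E →ₗ[ℝ] Fin (k + 1) → ℂ) e := he
    obtain ⟨w, hw⟩ := (he'.meanCurvature_eq_zero_iff hdim _).1 (hmin e he)
    have hsum : ∑ i, covHor ε v y (e i) (e i)
        = horL ε (v y) (∑ i, fderiv ℝ (fderiv ℝ v) y (e i) (e i)) := by
      rw [map_sum]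
      exact Finset.sum_congr rfl fun i _ => covHor_of_horizontal hv hh _ _
    rw [hsum, horL_apply, horProj, sub_eq_iff_eq_add] at hw
    exact ⟨w, _, hw⟩

end HorizontalData

section Join

variable {m : ℕ} {E : Type*} [NormedAddCommGroup E] [NormedSpace ℝ E]

/-- The cone `[a(t) v(x) + a'(t) Q]` over a horizontal lift `v` of a minimal Lagrangian immersion in
`ℂP^m` (`ε = 1`, `a = sinh`) or `ℂH^m` (`ε = -1`, `a = cosh`), where the Hermitian space of `v` is
embedded by `P` as the orthogonal complement of `Q`. -/
theorem minLagAt_join [FiniteDimensional ℝ E] {ε : ℤˣ} {v : E → Fin (m + 1) → ℂ} {y : E}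
    (P : (Fin (m + 1) → ℂ) →L[ℂ] (Fin (m + 2) → ℂ)) {Q : Fin (m + 2) → ℂ}
    (hPP : ∀ z w, herm (-1) (P z) (P w) = herm ε z w) (hPQ : ∀ z, herm (-1) (P z) Q = 0)
    (hQQ : herm (-1) Q Q = -((ε : ℤ) : ℂ)) {a a₁ : ℝ → ℝ}
    (ha : ∀ t, HasDerivAt a (a₁ t) t) (ha₁ : ∀ t, HasDerivAt a₁ (a t) t)
    (haa : ∀ t, a₁ t ^ 2 - a t ^ 2 = (ε : ℤ)) {s : ℝ} (has : a s ≠ 0)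
    (h : MinLagAt m (reHerm ε) (dHor ε v y) (covHor ε v y)) (hv : ContDiffAt ℝ 2 v y)
    (hq : ∀ᶠ x in 𝓝 y, herm ε (v x) (v x) = ((ε : ℤ) : ℂ))
    (hh : ∀ᶠ x in 𝓝 y, ∀ e, herm ε (fderiv ℝ v x e) (v x) = 0) :
    MinLagAt (m + 1) (reHerm (-1)) (dHor (-1) (cone a (fun t => a₁ t • Q) fun x => P (v x)) (s, y))
      (covHor (-1) (cone a (fun t => a₁ t • Q) fun x => P (v x)) (s, y)) := by
  obtain ⟨hpos, hlag, hmin⟩ := h.horizontal hv hq.self_of_nhds hh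
  let L : (Fin (m + 1) → ℂ) →L[ℝ] (Fin (m + 2) → ℂ) := P.restrictScalars ℝ
  have hdW : ∀ᶠ x in 𝓝 y, ∀ e, fderiv ℝ (fun x => P (v x)) x e = P (fderiv ℝ v x e) :=
    (hv.eventually (by simp)).mono fun x hx e =>
      fderiv_clm_comp L (hx.differentiableAt two_ne_zero) e
  have hW : ContDiffAt ℝ 2 (fun x => P (v x)) y := L.contDiff.contDiffAt.comp y hv
  have hQP : ∀ z, herm (-1) Q (P z) = 0 := fun z => by rw [← conj_herm, hPQ, map_zero]
  have haC : ∀ t, (a₁ t : ℂ) ^ 2 - (a t : ℂ) ^ 2 = ((ε : ℤ) : ℂ) := fun t => by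
    exact_mod_cast congrArg Complex.ofReal (haa t)
  have hεR : ((ε : ℤ) : ℝ) * ((ε : ℤ) : ℝ) = 1 := by exact_mod_cast sign_mul_self ε
  -- `a₁ (a₁ P v + a Q) - a (a P v + a₁ Q) = (a₁² - a²) P v = ε P v`
  refine minLagAt_cone (κ₁ := fun t => a t • Q) (Z := P (v y)) (r := ((ε : ℤ) : ℝ) * a₁ s)
    (r' := -(((ε : ℤ) : ℝ) * a s)) h.dim ha ha₁ (fun t => (ha₁ t).smul_const Q)
    (fun t => (ha t).smul_const Q) has hW ?_ ?_ ?_ ?_ ?_ ?_ ?_ ?_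
  · filter_upwards [hq] with x hx t
    simp only [cone, herm_add_left, herm_add_right, herm_real_smul_left, herm_real_smul_right, hPP,
      hPQ, hQP, hQQ, hx]
    linear_combination (-((ε : ℤ) : ℂ)) * haC t - sign_mul_self ε
  · filter_upwards [hq] with x hx t
    simp only [cone, herm_add_left, herm_add_right, herm_real_smul_left, herm_real_smul_right, hPP,
      hPQ, hQP, hQQ, hx]
    ring
  · filter_upwards [hdW, hh] with x hx hx' t e
    rw [hx, cone, herm_add_right, herm_real_smul_right, herm_real_smul_right, hPP, hPQ, hx']
    simp
  · intro e he
    rw [hdW.self_of_nhds, reHerm, hPP]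
    exact hpos e he
  · intro e e'
    rw [hdW.self_of_nhds, hdW.self_of_nhds, hPP, hlag]
  · exact neg_ne_zero.2 (mul_ne_zero (fun h0 => by simp [h0] at hεR) has)
  · simp only [cone]
    have h1 : ((ε : ℤ) : ℝ) * (a₁ s ^ 2 - a s ^ 2) = 1 := by rw [haa, hεR]
    have h2 : P (v y) = (((ε : ℤ) : ℝ) * (a₁ s ^ 2 - a s ^ 2)) • P (v y) := by rw [h1, one_smul]
    conv_lhs => rw [h2]
    module
  · intro e he
    have he' : IsFrame (reHerm ε) (fderiv ℝ v y) e := by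
      intro i j
      rw [← he i j, hdW.self_of_nhds, hdW.self_of_nhds, reHerm, reHerm, hPP]
    obtain ⟨w, c, hwc⟩ := hmin e he'
    refine ⟨w, c, ?_⟩
    have h2 : ∀ e e', fderiv ℝ (fderiv ℝ fun x => P (v x)) y e e'
        = P (fderiv ℝ (fderiv ℝ v) y e e') := fderiv_fderiv_clm_comp L hv
    rw [Finset.sum_congr rfl fun i _ => h2 (e i) (e i), ← map_sum, hwc, map_add, map_smul,
      hdW.self_of_nhds]

/-- The embedding `z ↦ (z, 0)`. -/
def appendL (k : ℕ) : (Fin k → ℂ) →L[ℂ] (Fin (k + 1) → ℂ) :=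
  LinearMap.toContinuousLinearMap
    { toFun := fun z => append z 0
      map_add' := fun z w => by
        funext i; induction i using Fin.lastCases <;> simp [append]
      map_smul' := fun c z => by
        funext i; induction i using Fin.lastCases <;> simp [append] }

theorem appendL_apply {k : ℕ} (z : Fin k → ℂ) : appendL k z = append z 0 := rfl

/-- The embedding `z ↦ (0, z)`. -/
def prependL (k : ℕ) : (Fin k → ℂ) →L[ℂ] (Fin (k + 1) → ℂ) :=
  LinearMap.toContinuousLinearMap
    { toFun := fun z => prepend 0 z
      map_add' := fun z w => by
        funext i; induction i using Fin.cases <;> simp [prepend]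
      map_smul' := fun c z => by
        funext i; induction i using Fin.cases <;> simp [prepend] }

theorem prependL_apply {k : ℕ} (z : Fin k → ℂ) : prependL k z = prepend 0 z := rfl

theorem herm_append_one {ε : ℤˣ} {k : ℕ} (z w : Fin (k + 1) → ℂ) (a b : ℂ) :
    herm ε (append z a) (append w b) = herm 1 z w + ((ε : ℤ) : ℂ) * (a * starRingEnd ℂ b) := by
  rw [herm_append, Fin.sum_univ_castSucc, herm]
  simp

theorem herm_prepend {ε : ℤˣ} {k : ℕ} (z w : Fin (k + 1) → ℂ) (a b : ℂ) :
    herm ε (prepend a z) (prepend b w) = a * starRingEnd ℂ b + herm ε z w := by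
  simp only [herm, prepend]
  rw [Fin.sum_univ_succ, ← Fin.succ_last]
  simp only [Fin.castSucc_zero, Fin.cons_zero, ← Fin.succ_castSucc, Fin.cons_succ]
  ring

/-- The lift `(sinh s · v, cosh s)` over a horizontal lift `v` to the sphere. The sphere of radius
`sinh s` around the vertex degenerates at `s = 0`, whence `0 < s`. -/
theorem minLagAt_coneA [FiniteDimensional ℝ E] {v : E → Fin (m + 1) → ℂ} {y : E} {s : ℝ}
    (hs : 0 < s) (h : MinLagAt m (reHerm 1) (dHor 1 v y) (covHor 1 v y)) (hv : ContDiffAt ℝ 2 v y)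
    (hq : ∀ᶠ x in 𝓝 y, herm 1 (v x) (v x) = (((1 : ℤˣ) : ℤ) : ℂ))
    (hh : ∀ᶠ x in 𝓝 y, ∀ e, herm 1 (fderiv ℝ v x e) (v x) = 0) :
    MinLagAt (m + 1) (reHerm (-1))
      (dHor (-1) (fun q : ℝ × E => append ((Real.sinh q.1 : ℂ) • v q.2) (Real.cosh q.1)) (s, y))
      (covHor (-1) (fun q : ℝ × E => append ((Real.sinh q.1 : ℂ) • v q.2) (Real.cosh q.1))
        (s, y)) := by
  have := minLagAt_join (ε := 1) (v := v) (y := y) (appendL (m + 1)) (Q := append 0 1)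
    (fun z w => by simp [appendL_apply, herm_append_one])
    (fun z => by simp [appendL_apply, herm_append_one, herm_zero_right])
    (by simp [herm_append_one, herm_zero_right]) Real.hasDerivAt_sinh Real.hasDerivAt_cosh
    (fun t => by simp [Real.cosh_sq]) (Real.sinh_pos_iff.2 hs).ne' h hv hq hh
  convert! this using 2 <;>
  · funext q i
    induction i using Fin.lastCases <;> simp [cone, appendL_apply, append]

/-- The lift `(sinh s, cosh s · v)` over a horizontal lift `v` to anti-de Sitter space. -/
theorem minLagAt_coneB [FiniteDimensional ℝ E] {v : E → Fin (m + 1) → ℂ} {y : E} (s : ℝ)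
    (h : MinLagAt m (reHerm (-1)) (dHor (-1) v y) (covHor (-1) v y)) (hv : ContDiffAt ℝ 2 v y)
    (hq : ∀ᶠ x in 𝓝 y, herm (-1) (v x) (v x) = (((-1 : ℤˣ) : ℤ) : ℂ))
    (hh : ∀ᶠ x in 𝓝 y, ∀ e, herm (-1) (fderiv ℝ v x e) (v x) = 0) :
    MinLagAt (m + 1) (reHerm (-1))
      (dHor (-1) (fun q : ℝ × E => prepend (Real.sinh q.1) ((Real.cosh q.1 : ℂ) • v q.2)) (s, y))
      (covHor (-1) (fun q : ℝ × E => prepend (Real.sinh q.1) ((Real.cosh q.1 : ℂ) • v q.2))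
        (s, y)) := by
  have := minLagAt_join (ε := -1) (v := v) (y := y) (prependL (m + 1)) (Q := prepend 1 0)
    (fun z w => by simp [prependL_apply, herm_prepend])
    (fun z => by simp [prependL_apply, herm_prepend, herm_zero_right])
    (by simp [herm_prepend, herm_zero_right]) Real.hasDerivAt_cosh Real.hasDerivAt_sinh
    (fun t => by simp [Real.cosh_sq]) (Real.cosh_pos s).ne' h hv hq hh
  convert! this using 2 <;>
  · funext q i
    induction i using Fin.cases <;> simp [cone, prependL_apply, prepend]

end Join

section Parabolic

variable {m : ℕ} {E : Type*} [NormedAddCommGroup E] [NormedSpace ℝ E]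

/-- The standard Hermitian form on `ℂ^m`. -/
def flatHerm (z w : Fin m → ℂ) : ℂ := ∑ i, z i * starRingEnd ℂ (w i)

theorem reFlat_eq (z w : Fin m → ℂ) : reFlat z w = (flatHerm z w).re := rfl

/-- The vector `(z, a, b)`. -/
def append₂ (z : Fin m → ℂ) (a b : ℂ) : Fin (m + 2) → ℂ := append (append z a) b

theorem append₂_add (z w : Fin m → ℂ) (a b c d : ℂ) :
    append₂ z a b + append₂ w c d = append₂ (z + w) (a + c) (b + d) := by
  funext i
  refine Fin.lastCases ?_ (fun i => ?_) i
  · simp [append₂, append]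
  · refine Fin.lastCases ?_ (fun i => ?_) i <;> simp [append₂, append]

theorem smul_append₂ (r : ℂ) (z : Fin m → ℂ) (a b : ℂ) :
    r • append₂ z a b = append₂ (r • z) (r * a) (r * b) := by
  funext i
  refine Fin.lastCases ?_ (fun i => ?_) i
  · simp [append₂, append]
  · refine Fin.lastCases ?_ (fun i => ?_) i <;> simp [append₂, append]

theorem herm_append₂ (z w : Fin m → ℂ) (a b c d : ℂ) :
    herm (-1) (append₂ z a b) (append₂ w c d)
      = flatHerm z w + a * starRingEnd ℂ c - b * starRingEnd ℂ d := by
  rw [append₂, append₂, herm_append_one, herm_append, flatHerm]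
  push_cast; ring

/-- The map `(z, c) ↦ (z, c/2, c/2)`. -/
def nullL (m : ℕ) : (Fin m → ℂ) × ℂ →L[ℝ] Fin (m + 2) → ℂ :=
  LinearMap.toContinuousLinearMap
    { toFun := fun p => append₂ p.1 (p.2 / 2) (p.2 / 2)
      map_add' := fun p q => by simp [append₂_add, add_div]
      map_smul' := fun r p => by
        rw [RingHom.id_apply, ← Complex.coe_smul r (append₂ _ _ _), smul_append₂]
        simp [mul_div_assoc] }

theorem nullL_apply (p : (Fin m → ℂ) × ℂ) : nullL m p = append₂ p.1 (p.2 / 2) (p.2 / 2) := rfl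

theorem herm_nullL (p q : (Fin m → ℂ) × ℂ) :
    herm (-1) (nullL m p) (nullL m q) = flatHerm p.1 q.1 := by
  rw [nullL_apply, nullL_apply, herm_append₂]; ring

theorem flatHerm_smul_right (c : ℂ) (z w : Fin m → ℂ) :
    flatHerm z (c • w) = starRingEnd ℂ c * flatHerm z w := by
  simp [flatHerm, Finset.mul_sum, mul_left_comm]

theorem flatHerm_smul_left (c : ℂ) (z w : Fin m → ℂ) :
    flatHerm (c • z) w = c * flatHerm z w := by
  simp [flatHerm, Finset.mul_sum, mul_assoc]

theorem reFlat_self_pos {z : Fin m → ℂ} (hz : z ≠ 0) : 0 < reFlat z z := by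
  have : reFlat z z = ∑ i, ‖z i‖ ^ 2 := by
    simp only [reFlat, Complex.mul_conj, Complex.normSq_eq_norm_sq, Complex.re_sum,
      Complex.ofReal_re]
  rw [this]
  obtain ⟨i, hi⟩ := Function.ne_iff.1 hz
  have hi' := norm_pos_iff.2 hi
  exact Finset.sum_pos' (fun _ _ => by positivity) ⟨i, Finset.mem_univ i, by positivity⟩

theorem flatHerm_self (z : Fin m → ℂ) : flatHerm z z = (reFlat z z : ℂ) := by
  rw [reFlat_eq]
  simp only [flatHerm, Complex.mul_conj]
  rw [← Complex.ofReal_sum, Complex.ofReal_re]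

/-- The real inner product of `ℂ^m` as a bilinear map. -/
def reFlatL (m : ℕ) : (Fin m → ℂ) →ₗ[ℝ] (Fin m → ℂ) →ₗ[ℝ] ℝ :=
  (reHermL (-1) (m + 1)).compl₁₂ ((nullL m).toLinearMap ∘ₗ LinearMap.inl ℝ _ ℂ)
    ((nullL m).toLinearMap ∘ₗ LinearMap.inl ℝ _ ℂ)

theorem reFlatL_apply (z w : Fin m → ℂ) : reFlatL m z w = reFlat z w := by
  change reHerm (-1) (nullL m (z, 0)) (nullL m (w, 0)) = _
  rw [reHerm, herm_nullL, reFlat_eq]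

/-- The lift `eˢ (η, φ/2, φ/2) + (0, -sinh s, cosh s)` over a minimal Lagrangian immersion `η` in
`ℂ^m`. The equation `dφ = 2 (dη, η)` says that the lift is horizontal. Since `(0, 1, 1)` is a null
vector orthogonal to all `(dη, 0, 0)`, the metric does not see `φ`, and the trace of the second
derivative of `φ` contributes a multiple of `(0, 1, 1)`, which is `eˢ` times the difference of the
position vector and its `s`-derivative. -/
theorem minLagAt_coneC [FiniteDimensional ℝ E] {η : E → Fin m → ℂ} {φ : E → ℂ} {y : E} (s : ℝ)
    (h : MinLagAt m reFlat (fderiv ℝ η y) (fun a b => fderiv ℝ (fun x => fderiv ℝ η x b) y a))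
    (hη : ContDiffAt ℝ 2 η y) (hφ : ContDiffAt ℝ 2 φ y)
    (hre : ∀ᶠ x in 𝓝 y, (φ x).re = reFlat (η x) (η x))
    (hd : ∀ᶠ x in 𝓝 y, ∀ e, fderiv ℝ φ x e = 2 * flatHerm (fderiv ℝ η x e) (η x)) :
    MinLagAt (m + 1) (reHerm (-1))
      (dHor (-1) (fun q : ℝ × E => (Real.exp q.1 : ℂ) • append₂ (η q.2) (φ q.2 / 2) (φ q.2 / 2)
        + append₂ 0 (-(Real.sinh q.1 : ℂ)) (Real.cosh q.1)) (s, y))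
      (covHor (-1) (fun q : ℝ × E => (Real.exp q.1 : ℂ) • append₂ (η q.2) (φ q.2 / 2) (φ q.2 / 2)
        + append₂ 0 (-(Real.sinh q.1 : ℂ)) (Real.cosh q.1)) (s, y)) := by
  have hpair : ContDiffAt ℝ 2 (fun x => (η x, φ x)) y := hη.prodMk hφ
  set W : E → Fin (m + 2) → ℂ := fun x => nullL m (η x, φ x) with hWdef
  have hW : ContDiffAt ℝ 2 W y := (nullL m).contDiff.contDiffAt.comp y hpair
  have hdW : ∀ᶠ x in 𝓝 y, ∀ e, fderiv ℝ W x e = nullL m (fderiv ℝ η x e, fderiv ℝ φ x e) := by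
    filter_upwards [hη.eventually (by simp), hφ.eventually (by simp)] with x h1 h2 e
    have h1 := h1.differentiableAt two_ne_zero
    have h2 := h2.differentiableAt two_ne_zero
    rw [hWdef, fderiv_clm_comp (v := fun x => (η x, φ x)) (nullL m) (h1.prodMk h2),
      h1.fderiv_prodMk h2]
    rfl
  set κ : ℝ → Fin (m + 2) → ℂ := fun t => append₂ 0 (-(Real.sinh t : ℂ)) (Real.cosh t) with hκdef
  set κ₁ : ℝ → Fin (m + 2) → ℂ := fun t => append₂ 0 (-(Real.cosh t : ℂ)) (Real.sinh t) with hκ₁def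
  have hcoord : ∀ f g : ℝ → ℂ, (fun t => append₂ (0 : Fin m → ℂ) (f t) (g t))
      = fun t => f t • append₂ 0 1 0 + g t • append₂ 0 0 1 := by
    intro f g
    funext t
    simp [smul_append₂, append₂_add]
  have hsinh : ∀ t : ℝ, HasDerivAt (fun t : ℝ => (Real.sinh t : ℂ)) (Real.cosh t) t := fun t =>
    (Real.hasDerivAt_sinh t).ofReal_comp
  have hcosh : ∀ t : ℝ, HasDerivAt (fun t : ℝ => (Real.cosh t : ℂ)) (Real.sinh t) t := fun t =>
    (Real.hasDerivAt_cosh t).ofReal_comp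
  have hκ : ∀ t, HasDerivAt κ (κ₁ t) t := by
    intro t
    have h1 := congrFun (hcoord (fun t => -(Real.cosh t : ℂ)) fun t => (Real.sinh t : ℂ)) t
    rw [hκdef, hκ₁def, hcoord (fun t => -(Real.sinh t : ℂ)) fun t => (Real.cosh t : ℂ)]
    simp only at h1 ⊢
    rw [h1]
    exact ((hsinh t).neg.smul_const _).add ((hcosh t).smul_const _)
  have hκ₁ : ∀ t, HasDerivAt κ₁ (κ t) t := by
    intro t
    have h1 := congrFun (hcoord (fun t => -(Real.sinh t : ℂ)) fun t => (Real.cosh t : ℂ)) t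
    rw [hκdef, hκ₁def, hcoord (fun t => -(Real.cosh t : ℂ)) fun t => (Real.sinh t : ℂ)]
    simp only at h1 ⊢
    rw [h1]
    exact ((hcosh t).neg.smul_const _).add ((hsinh t).smul_const _)
  have hexp : ∀ t : ℝ, (Real.exp t : ℂ) = Real.cosh t + Real.sinh t := fun t => by
    exact_mod_cast (Real.cosh_add_sinh t).symm
  have hWκ : ∀ p t, herm (-1) (nullL m p) (κ t) = -(Real.exp t * p.2 / 2) := by
    intro p t
    rw [nullL_apply, hκdef, herm_append₂, hexp]
    simp [flatHerm, -Complex.ofReal_cosh, -Complex.ofReal_sinh]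
    ring
  have hκW : ∀ p t, herm (-1) (κ t) (nullL m p) = -(Real.exp t * starRingEnd ℂ p.2 / 2) := by
    intro p t
    rw [← conj_herm, hWκ]
    simp [-Complex.ofReal_exp, map_ofNat]
  have hκ₁W : ∀ p t, herm (-1) (κ₁ t) (nullL m p) = -(Real.exp t * starRingEnd ℂ p.2 / 2) := by
    intro p t
    rw [nullL_apply, hκ₁def, herm_append₂, hexp]
    simp [flatHerm, map_ofNat, -Complex.ofReal_cosh, -Complex.ofReal_sinh]
    ring
  have hκκ : ∀ t, herm (-1) (κ t) (κ t) = -1 := by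
    intro t
    rw [hκdef, herm_append₂]
    simp [flatHerm, -Complex.ofReal_cosh, -Complex.ofReal_sinh]
    linear_combination -cosh_sq_ofReal t
  have hκ₁κ : ∀ t, herm (-1) (κ₁ t) (κ t) = 0 := by
    intro t
    rw [hκdef, hκ₁def, herm_append₂]
    simp [flatHerm, -Complex.ofReal_cosh, -Complex.ofReal_sinh]
    ring
  have hφφ : ∀ᶠ x in 𝓝 y, φ x + starRingEnd ℂ (φ x) = 2 * flatHerm (η x) (η x) := by
    filter_upwards [hre] with x hx
    rw [flatHerm_self, ← hx, Complex.add_conj]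
    push_cast; ring
  have hcone : (fun q : ℝ × E => (Real.exp q.1 : ℂ) • append₂ (η q.2) (φ q.2 / 2) (φ q.2 / 2)
        + append₂ 0 (-(Real.sinh q.1 : ℂ)) (Real.cosh q.1)) = cone Real.exp κ W := by
    funext q
    rw [Complex.coe_smul]
    rfl
  have hmet : ∀ e e', herm (-1) (fderiv ℝ W y e) (fderiv ℝ W y e')
      = flatHerm (fderiv ℝ η y e) (fderiv ℝ η y e') := by
    intro e e'
    rw [hdW.self_of_nhds, hdW.self_of_nhds, herm_nullL]
  have hg : reFlat = fun v w : Fin m → ℂ => reFlatL m v w := by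
    funext v w; rw [reFlatL_apply]
  rw [hcone]
  refine minLagAt_cone (κ₁ := κ₁) (Z := append₂ 0 1 1) (r := -Real.exp s) (r' := Real.exp s) h.dim
    Real.hasDerivAt_exp Real.hasDerivAt_exp hκ hκ₁ (Real.exp_pos s).ne' hW ?_ ?_ ?_ ?_ ?_
    (Real.exp_pos s).ne' ?_ ?_
  · filter_upwards [hφφ] with x hx t
    simp only [cone, hWdef, herm_add_left, herm_add_right, herm_real_smul_left,
      herm_real_smul_right, herm_nullL, hWκ, hκW, hκκ]
    linear_combination (-(Real.exp t : ℂ) ^ 2 / 2) * hx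
  · filter_upwards [hφφ] with x hx t
    simp only [cone, hWdef, herm_add_left, herm_add_right, herm_real_smul_left,
      herm_real_smul_right, herm_nullL, hWκ, hκ₁W, hκ₁κ]
    linear_combination (-(Real.exp t : ℂ) ^ 2 / 2) * hx
  · filter_upwards [hdW, hd] with x hx hx' t e
    rw [hx, cone, hWdef, herm_add_right, herm_real_smul_right, herm_nullL, hWκ, hx']
    ring
  · intro e he
    rw [reHerm, hmet]
    refine reFlat_self_pos fun h0 => he (h.immersion ?_)
    rw [h0, map_zero]
  · intro e e'
    rw [hmet]
    have := h.lagrangian e e'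
    rw [reFlat_eq, flatHerm_smul_left] at this
    simpa using this
  · have h1 : (Real.exp s : ℂ) * (Real.cosh s - Real.sinh s) = 1 := by
      rw [hexp]
      linear_combination cosh_sq_ofReal s
    rw [← Complex.coe_smul, ← Complex.coe_smul, cone, cone, hκdef, hκ₁def, ← Complex.coe_smul]
    have h2 : append₂ (0 : Fin m → ℂ) 1 1
        = (Real.exp s : ℂ) • (append₂ 0 (-(Real.sinh s : ℂ)) (Real.cosh s)
          + (-1 : ℂ) • append₂ 0 (-(Real.cosh s : ℂ)) (Real.sinh s)) := by
      rw [smul_append₂, append₂_add, smul_append₂]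
      congr 1
      · simp
      · linear_combination -h1
      · linear_combination -h1
    rw [h2]
    push_cast
    module
  · intro e he
    have he' : ∀ i j, reFlat (fderiv ℝ η y (e i)) (fderiv ℝ η y (e j)) = if i = j then 1 else 0 := by
      intro i j
      rw [← he i j, reHerm, hmet, reFlat_eq]
    have he'' : IsFrame (fun v w => reFlatL m v w) (fderiv ℝ η y : E →ₗ[ℝ] Fin m → ℂ) e := by
      rw [← hg]; exact he'
    have hm := h.minimal e he'
    rw [hg] at hm
    obtain ⟨w, hw⟩ := (he''.meanCurvature_eq_zero_iff h.dim _).1 hm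
    simp only [fderiv_fderiv_apply hη] at hw
    have hw' : ∑ i, fderiv ℝ (fderiv ℝ η) y (e i) (e i) = fderiv ℝ η y w := hw
    have h2 : ∀ e e', fderiv ℝ (fderiv ℝ W) y e e'
        = nullL m (fderiv ℝ (fderiv ℝ η) y e e', fderiv ℝ (fderiv ℝ φ) y e e') := by
      intro e e'
      rw [hWdef, fderiv_fderiv_clm_comp (nullL m) hpair]
      congr 1
      exact Prod.ext
        (fderiv_fderiv_clm_comp (ContinuousLinearMap.fst ℝ (Fin m → ℂ) ℂ) hpair e e').symm
        (fderiv_fderiv_clm_comp (ContinuousLinearMap.snd ℝ (Fin m → ℂ) ℂ) hpair e e').symm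
    refine ⟨w, (∑ i, fderiv ℝ (fderiv ℝ φ) y (e i) (e i) - fderiv ℝ φ y w) / 2, ?_⟩
    rw [Finset.sum_congr rfl fun i _ => h2 (e i) (e i), ← map_sum, hdW.self_of_nhds, nullL_apply,
      nullL_apply, smul_append₂, append₂_add, Prod.fst_sum, Prod.snd_sum, hw']
    congr 1
    · simp
    all_goals ring

end Parabolic

/-! ### From charts to the manifold -/

section Chart

variable {E : Type*} [NormedAddCommGroup E] [NormedSpace ℝ E] {H : Type*} [TopologicalSpace H]
  {I : ModelWithCorners ℝ E H} {M : Type*} [TopologicalSpace M] [ChartedSpace H M]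
  {V : Type*} [NormedAddCommGroup V] [NormedSpace ℝ V]

theorem contMDiffAt_iff_chart [I.Boundaryless] {n : WithTop ℕ∞} {f : M → V} {p : M} :
    ContMDiffAt I 𝓘(ℝ, V) n f p ↔ ContinuousAt f p ∧
      ContDiffAt ℝ n (f ∘ (extChartAt I p).symm) (extChartAt I p p) := by
  rw [contMDiffAt_iff, I.range_eq_univ, contDiffWithinAt_univ, extChartAt_model_space_eq_id]
  rfl

theorem tendsto_extChartAt_symm (p : M) :
    Tendsto (extChartAt I p).symm (𝓝 (extChartAt I p p)) (𝓝 p) := by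
  have := continuousAt_extChartAt_symm (I := I) p
  rwa [ContinuousAt, extChartAt_to_inv] at this

/-- The derivative of a coordinate expression in the chart at `p`, at other points of the chart. -/
theorem fderiv_comp_extChartAt_symm [I.Boundaryless] [IsManifold I 1 M] {f : M → V} {p : M} {y : E}
    (hf : MDifferentiableAt I 𝓘(ℝ, V) f ((extChartAt I p).symm y))
    (hy : y ∈ (extChartAt I p).target) (a : E) :
    fderiv ℝ (f ∘ (extChartAt I p).symm) y a
      = mfderiv I 𝓘(ℝ, V) f ((extChartAt I p).symm y)
          (mfderiv 𝓘(ℝ, E) I (extChartAt I p).symm y a) := by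
  have h1 : MDifferentiableAt 𝓘(ℝ, E) I (extChartAt I p).symm y := by
    have := mdifferentiableWithinAt_extChartAt_symm (I := I) hy
    rwa [I.range_eq_univ, mdifferentiableWithinAt_univ] at this
  rw [← mfderiv_eq_fderiv, mfderiv_comp y hf h1]
  rfl

variable {ε : ℤˣ} {k : ℕ}

theorem IsLocalLift.contDiffAt [I.Boundaryless] {φ : M → SpaceForm ε k} {p : M} {U : Set M}
    {F : M → Fin (k + 1) → ℂ} (h : IsLocalLift I φ p U F) :
    ContDiffAt ℝ ∞ (F ∘ (extChartAt I p).symm) (extChartAt I p p) :=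
  (contMDiffAt_iff_chart.1 (h.smooth.contMDiffAt (h.isOpen.mem_nhds h.mem))).2

theorem hopf_eq_iff {z w : Quadric ε k} : hopf z = hopf w ↔ ∃ c : Circle, w.1 = (c : ℂ) • z.1 :=
  ⟨fun h => Quotient.exact h, fun h => Quotient.sound h⟩

/-- It suffices to check the conditions for one global lift, in coordinates. -/
theorem isMinLag_of_lift [I.Boundaryless] {φ : M → SpaceForm ε k} {F : M → Fin (k + 1) → ℂ}
    (hF : ContMDiff I 𝓘(ℝ, Fin (k + 1) → ℂ) ∞ F)
    (hl : ∀ x, ∃ h : herm ε (F x) (F x) = ((ε : ℤ) : ℂ), hopf ⟨F x, h⟩ = φ x)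
    (hm : ∀ p : M, ∃ v : E → Fin (k + 1) → ℂ,
      F ∘ (extChartAt I p).symm =ᶠ[𝓝 (extChartAt I p p)] v ∧
      MinLagAt k (reHerm ε) (dHor ε v (extChartAt I p p)) (covHor ε v (extChartAt I p p))) :
    IsMinLag I φ := by
  refine ⟨fun p => ⟨Set.univ, F, isOpen_univ, trivial, hF.contMDiffOn, fun x _ => hl x⟩, ?_⟩
  intro p U K hK
  obtain ⟨v, hv, hmv⟩ := hm p
  have hFp := (contMDiffAt_iff_chart.1 (hF p)).2.of_le two_le_infty
  refine hmv.gauge (hFp.congr_of_eventuallyEq hv.symm) (hK.contDiffAt.of_le two_le_infty) ?_ ?_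
  · filter_upwards [hv] with x hx
    rw [← hx]
    exact (hl _).choose
  · have hU := (tendsto_extChartAt_symm (I := I) p).eventually (hK.isOpen.mem_nhds hK.mem)
    filter_upwards [hv, hU] with x hx hxU
    obtain ⟨h1, h1'⟩ := hl ((extChartAt I p).symm x)
    obtain ⟨h2, h2'⟩ := hK.lifts _ hxU
    rw [← hx]
    exact hopf_eq_iff.1 (h1'.trans h2'.symm)

theorem IsHorizontalLift.horizontal_chart [I.Boundaryless] [IsManifold I 1 M]
    {φ : M → SpaceForm ε k} {G : M → Quadric ε k} (h : IsHorizontalLift I φ G) (p : M) :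
    ∀ᶠ y in 𝓝 (extChartAt I p p), ∀ a,
      herm ε (fderiv ℝ ((fun x => (G x).1) ∘ (extChartAt I p).symm) y a)
        (((fun x => (G x).1) ∘ (extChartAt I p).symm) y) = 0 := by
  filter_upwards [extChartAt_target_mem_nhds (I := I) p] with y hy a
  rw [fderiv_comp_extChartAt_symm (h.smooth.mdifferentiable (by simp) _) hy]
  exact h.horizontal _ _

theorem IsHorizontalLift.minLagAt {φ : M → SpaceForm ε k}
    {G : M → Quadric ε k} (h : IsHorizontalLift I φ G) (hφ : IsMinLag I φ) (p : M) :
    MinLagAt k (reHerm ε) (dHor ε ((fun x => (G x).1) ∘ (extChartAt I p).symm) (extChartAt I p p))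
      (covHor ε ((fun x => (G x).1) ∘ (extChartAt I p).symm) (extChartAt I p p)) :=
  hφ.minLag p Set.univ _
    ⟨isOpen_univ, trivial, h.smooth.contMDiffOn, fun x _ => ⟨(G x).2, h.lifts x⟩⟩

end Chart

section Products

variable {m : ℕ} {N : Type*} [TopologicalSpace N] [ChartedSpace (EuclideanSpace ℝ (Fin m)) N]

theorem eventually_extChartAt_posReal_symm (s : posReal) :
    ∀ᶠ t in 𝓝 (extChartAt 𝓘(ℝ, ℝ) s s), (((extChartAt 𝓘(ℝ, ℝ) s).symm t : posReal) : ℝ) = t := by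
  filter_upwards [extChartAt_target_mem_nhds (I := 𝓘(ℝ, ℝ)) s] with t ht
  exact (extChartAt 𝓘(ℝ, ℝ) s).right_inv ht

theorem contMDiff_posReal_val : ContMDiff 𝓘(ℝ, ℝ) 𝓘(ℝ, ℝ) ∞ (fun s : posReal => (s : ℝ)) :=
  contMDiff_subtype_val

theorem isMinLag_mapA [IsManifold (𝓡 m) ∞ N] {φ : N → CP m} (hφ : IsMinLag (𝓡 m) φ)
    {G : N → Quadric 1 m} (hG : IsHorizontalLift (𝓡 m) φ G) :
    IsMinLag (𝓘(ℝ, ℝ).prod (𝓡 m)) (mapA G) := by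
  have : IsManifold (𝓡 m) 1 N := IsManifold.of_le (n := ∞) (by simp)
  refine isMinLag_of_lift (F := fun q : posReal × N =>
    append ((Real.sinh q.1 : ℂ) • (G q.2).1) (Real.cosh q.1)) ?_ (fun q => ⟨_, rfl⟩) ?_
  · have h1 : ContDiff ℝ ∞ (fun p : ℝ × (Fin (m + 1) → ℂ) =>
        append ((Real.sinh p.1 : ℂ) • p.2) (Real.cosh p.1)) := by
      rw [contDiff_pi]
      intro i
      induction i using Fin.lastCases with
      | last =>
        simp only [append, Fin.snoc_last]
        exact Complex.ofRealCLM.contDiff.comp (Real.contDiff_cosh.comp contDiff_fst)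
      | cast i =>
        simp only [append, Fin.snoc_castSucc, Pi.smul_apply, smul_eq_mul]
        exact (Complex.ofRealCLM.contDiff.comp (Real.contDiff_sinh.comp contDiff_fst)).mul
          ((contDiff_apply ℝ ℂ i).comp contDiff_snd)
    have h2 : ContMDiff (𝓘(ℝ, ℝ).prod (𝓡 m)) 𝓘(ℝ, ℝ) ∞ (fun q : posReal × N => (q.1 : ℝ)) :=
      contMDiff_posReal_val.comp contMDiff_fst
    have h3 : ContMDiff (𝓘(ℝ, ℝ).prod (𝓡 m)) 𝓘(ℝ, Fin (m + 1) → ℂ) ∞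
        (fun q : posReal × N => (G q.2).1) := hG.smooth.comp contMDiff_snd
    have h4 := h2.prodMk_space h3
    have h5 := h1.contMDiff.comp h4
    exact h5
  · rintro ⟨s, x⟩
    refine ⟨_, ?_, minLagAt_coneA (s := s) (y := extChartAt (𝓡 m) x x) s.2 (hG.minLagAt hφ x)
      ((contMDiffAt_iff_chart.1 (hG.smooth x)).2.of_le two_le_infty)
      (.of_forall fun y => (G _).2) (hG.horizontal_chart x)⟩
    rw [extChartAt_prod]
    have hs := eventually_extChartAt_posReal_symm s
    have : Tendsto Prod.fst (𝓝 (extChartAt 𝓘(ℝ, ℝ) s s, extChartAt (𝓡 m) x x))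
      (𝓝 (extChartAt 𝓘(ℝ, ℝ) s s)) := continuousAt_fst
    filter_upwards [this.eventually hs] with q hq
    simp only [Function.comp, PartialEquiv.prod_coe_symm, hq]

theorem isMinLag_mapB [IsManifold (𝓡 m) ∞ N] {φ : N → CH m} (hφ : IsMinLag (𝓡 m) φ)
    {G : N → Quadric (-1) m} (hG : IsHorizontalLift (𝓡 m) φ G) :
    IsMinLag (𝓘(ℝ, ℝ).prod (𝓡 m)) (mapB G) := by
  have : IsManifold (𝓡 m) 1 N := IsManifold.of_le (n := ∞) (by simp)
  refine isMinLag_of_lift (F := fun q : ℝ × N =>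
    prepend (Real.sinh q.1) ((Real.cosh q.1 : ℂ) • (G q.2).1)) ?_ (fun q => ⟨_, rfl⟩) ?_
  · have h1 : ContDiff ℝ ∞ (fun p : ℝ × (Fin (m + 1) → ℂ) =>
        prepend (Real.sinh p.1) ((Real.cosh p.1 : ℂ) • p.2)) := by
      rw [contDiff_pi]
      intro i
      induction i using Fin.cases with
      | zero =>
        simp only [prepend, Fin.cons_zero]
        exact Complex.ofRealCLM.contDiff.comp (Real.contDiff_sinh.comp contDiff_fst)
      | succ i =>
        simp only [prepend, Fin.cons_succ, Pi.smul_apply, smul_eq_mul]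
        exact (Complex.ofRealCLM.contDiff.comp (Real.contDiff_cosh.comp contDiff_fst)).mul
          ((contDiff_apply ℝ ℂ i).comp contDiff_snd)
    exact h1.contMDiff.comp (contMDiff_fst.prodMk_space (hG.smooth.comp contMDiff_snd))
  · rintro ⟨s, x⟩
    refine ⟨_, ?_, minLagAt_coneB (y := extChartAt (𝓡 m) x x) s (hG.minLagAt hφ x)
      ((contMDiffAt_iff_chart.1 (hG.smooth x)).2.of_le two_le_infty)
      (.of_forall fun y => (G _).2) (hG.horizontal_chart x)⟩
    rw [extChartAt_prod]
    exact .of_forall fun q => rfl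

/-! ### Smoothness of the potential -/

theorem fderiv_reFlat_self {E : Type*} [NormedAddCommGroup E] [NormedSpace ℝ E]
    {η : E → Fin m → ℂ} {x : E} (hη : DifferentiableAt ℝ η x) (a : E) :
    fderiv ℝ (fun x => reFlat (η x) (η x)) x a = 2 * reFlat (fderiv ℝ η x a) (η x) := by
  have := ((reFlatL m).toContinuousBilinearMap.hasFDerivAt_of_bilinear hη.hasFDerivAt
    hη.hasFDerivAt).fderiv
  simp only [LinearMap.toContinuousBilinearMap_apply, reFlatL_apply] at this
  rw [this]
  have hcomm : reFlat (η x) (fderiv ℝ η x a) = reFlat (fderiv ℝ η x a) (η x) := by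
    rw [← reFlatL_apply, ← reFlatL_apply]; exact reHerm_comm _ _
  change reFlatL m (η x) (fderiv ℝ η x a) + reFlatL m (fderiv ℝ η x a) (η x) = _
  rw [reFlatL_apply, reFlatL_apply, hcomm]; ring

theorem contDiff_reFlat : ContDiff ℝ ∞ (fun p : (Fin m → ℂ) × (Fin m → ℂ) => reFlat p.1 p.2) := by
  have : (fun p : (Fin m → ℂ) × (Fin m → ℂ) => reFlat p.1 p.2)
      = fun p => (reFlatL m).toContinuousBilinearMap p.1 p.2 := by
    funext p; rw [← reFlatL_apply]; rfl
  rw [this]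
  exact (reFlatL m).toContinuousBilinearMap.isBoundedBilinearMap.contDiff

variable [IsManifold (𝓡 m) ∞ N] {η : N → Fin m → ℂ} {f : N → ℂ}

theorem IsPotential.fderiv_im (hη : IsMinLagFlat (𝓡 m) η) (hf : IsPotential (𝓡 m) η f) {p : N}
    {y : EuclideanSpace ℝ (Fin m)} (hy : y ∈ (extChartAt (𝓡 m) p).target)
    (a : EuclideanSpace ℝ (Fin m)) :
    fderiv ℝ ((fun x => (f x).im) ∘ (extChartAt (𝓡 m) p).symm) y a
      = 2 * reFlat (fderiv ℝ (η ∘ (extChartAt (𝓡 m) p).symm) y a)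
        (Complex.I • η ((extChartAt (𝓡 m) p).symm y)) := by
  have : IsManifold (𝓡 m) 1 N := IsManifold.of_le (n := ∞) (by simp)
  rw [fderiv_comp_extChartAt_symm (hf.differentiable _) hy, hf.im_eq,
    fderiv_comp_extChartAt_symm (hη.smooth.mdifferentiable (by simp) _) hy]
  rfl

/-- A potential is smooth: the differential of its imaginary part is. -/
theorem IsPotential.contMDiff (hη : IsMinLagFlat (𝓡 m) η) (hf : IsPotential (𝓡 m) η f) :
    ContMDiff (𝓡 m) 𝓘(ℝ, ℂ) ∞ f := by
  have : IsManifold (𝓡 m) 1 N := IsManifold.of_le (n := ∞) (by simp)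
  have hre : ContMDiff (𝓡 m) 𝓘(ℝ, ℝ) ∞ (fun x => (f x).re) := by
    simp only [hf.re_eq]
    exact contDiff_reFlat.contMDiff.comp (hη.smooth.prodMk_space hη.smooth)
  have him : ContMDiff (𝓡 m) 𝓘(ℝ, ℝ) ∞ (fun x => (f x).im) := by
    intro p
    rw [contMDiffAt_iff_chart]
    refine ⟨hf.differentiable.continuous.continuousAt, ?_⟩
    have hopen : IsOpen (extChartAt (𝓡 m) p).target := isOpen_extChartAt_target p
    refine ContDiffOn.contDiffAt ?_ (extChartAt_target_mem_nhds (I := 𝓡 m) p)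
    have hηc : ContDiffOn ℝ ∞ (η ∘ (extChartAt (𝓡 m) p).symm) (extChartAt (𝓡 m) p).target :=
      contMDiffOn_iff_contDiffOn.1 (hη.smooth.comp_contMDiffOn (contMDiffOn_extChartAt_symm p))
    rw [contDiffOn_infty_iff_fderiv_of_isOpen hopen]
    constructor
    · intro y hy
      have h1 : MDifferentiableAt 𝓘(ℝ, EuclideanSpace ℝ (Fin m)) (𝓡 m) (extChartAt (𝓡 m) p).symm y := by
        have := mdifferentiableWithinAt_extChartAt_symm (I := 𝓡 m) hy
        rwa [ModelWithCorners.range_eq_univ, mdifferentiableWithinAt_univ] at this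
      exact (((hf.differentiable _).comp y h1).differentiableAt).differentiableWithinAt
    · rw [contDiffOn_clm_apply]
      intro a
      refine ContDiffOn.congr ?_ fun y hy => hf.fderiv_im hη hy a
      have h2 : ContDiffOn ℝ ∞ (fun y => fderiv ℝ (η ∘ (extChartAt (𝓡 m) p).symm) y a)
          (extChartAt (𝓡 m) p).target :=
        ((contDiffOn_infty_iff_fderiv_of_isOpen hopen).1 hηc).2.clm_apply contDiffOn_const
      have h3 : ContDiffOn ℝ ∞ (fun y => Complex.I • (η ∘ (extChartAt (𝓡 m) p).symm) y)
          (extChartAt (𝓡 m) p).target := hηc.const_smul Complex.I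
      have h4 := contDiff_reFlat.comp_contDiffOn (h2.prodMk h3)
      exact contDiffOn_const.mul h4
  have : f = fun x => ((f x).re : ℂ) + ((f x).im : ℂ) * Complex.I := by
    funext x; rw [Complex.re_add_im]
  rw [this]
  have h3 : ContDiff ℝ ∞ (fun p : ℝ × ℝ => (p.1 : ℂ) + (p.2 : ℂ) * Complex.I) :=
    (Complex.ofRealCLM.contDiff.comp contDiff_fst).add
      ((Complex.ofRealCLM.contDiff.comp contDiff_snd).mul contDiff_const)
  have h4 := hre.prodMk_space him
  exact h3.contMDiff.comp h4

/-- In a chart, the defining conditions of a potential combine to `df = 2 (dη, η)`, with the Hermitian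
product on the right. -/
theorem IsPotential.fderiv_chart (hη : IsMinLagFlat (𝓡 m) η) (hf : IsPotential (𝓡 m) η f) {p : N}
    {y : EuclideanSpace ℝ (Fin m)} (hy : y ∈ (extChartAt (𝓡 m) p).target)
    (a : EuclideanSpace ℝ (Fin m)) :
    fderiv ℝ (f ∘ (extChartAt (𝓡 m) p).symm) y a
      = 2 * flatHerm (fderiv ℝ (η ∘ (extChartAt (𝓡 m) p).symm) y a)
        (η ((extChartAt (𝓡 m) p).symm y)) := by
  have hopen : (extChartAt (𝓡 m) p).target ∈ 𝓝 y := (isOpen_extChartAt_target p).mem_nhds hy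
  have hηd : DifferentiableAt ℝ (η ∘ (extChartAt (𝓡 m) p).symm) y :=
    ((contMDiffOn_iff_contDiffOn.1 (hη.smooth.comp_contMDiffOn
      (contMDiffOn_extChartAt_symm p))).contDiffAt hopen).differentiableAt (by simp)
  have hfd : DifferentiableAt ℝ (f ∘ (extChartAt (𝓡 m) p).symm) y :=
    ((contMDiffOn_iff_contDiffOn.1 ((hf.contMDiff hη).comp_contMDiffOn
      (contMDiffOn_extChartAt_symm p))).contDiffAt hopen).differentiableAt (by simp)
  apply Complex.ext
  · have h1 := fderiv_clm_comp Complex.reCLM hfd a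
    have h2 : (fun x => Complex.reCLM ((f ∘ (extChartAt (𝓡 m) p).symm) x))
        = fun x => reFlat ((η ∘ (extChartAt (𝓡 m) p).symm) x)
          ((η ∘ (extChartAt (𝓡 m) p).symm) x) := by
      funext x; exact hf.re_eq _
    rw [h2, fderiv_reFlat_self hηd] at h1
    rw [Complex.reCLM_apply] at h1
    rw [← h1, reFlat_eq]
    simp
  · have h1 := fderiv_clm_comp Complex.imCLM hfd a
    rw [Complex.imCLM_apply] at h1
    rw [← h1]
    refine (hf.fderiv_im hη hy a).trans ?_
    rw [reFlat_eq, flatHerm_smul_right]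
    simp

theorem isMinLag_mapC (hη : IsMinLagFlat (𝓡 m) η) (hf : IsPotential (𝓡 m) η f) :
    IsMinLag (𝓘(ℝ, ℝ).prod (𝓡 m)) (mapC η f hf.re_eq) := by
  have hfs := hf.contMDiff hη
  refine isMinLag_of_lift (F := fun q : ℝ × N =>
    (Real.exp q.1 : ℂ) • append₂ (η q.2) (f q.2 / 2) (f q.2 / 2)
      + append₂ 0 (-(Real.sinh q.1 : ℂ)) (Real.cosh q.1)) ?_ (fun q => ⟨_, rfl⟩) ?_
  · have h1 : ContDiff ℝ ∞ (fun p : ℝ × ((Fin m → ℂ) × ℂ) =>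
        (Real.exp p.1 : ℂ) • append₂ p.2.1 (p.2.2 / 2) (p.2.2 / 2)
          + append₂ 0 (-(Real.sinh p.1 : ℂ)) (Real.cosh p.1)) := by
      have hof : ∀ {g : ℝ → ℝ}, ContDiff ℝ ∞ g →
          ContDiff ℝ ∞ (fun p : ℝ × ((Fin m → ℂ) × ℂ) => (g p.1 : ℂ)) := fun hg =>
        Complex.ofRealCLM.contDiff.comp (hg.comp contDiff_fst)
      have hnull : ContDiff ℝ ∞ (fun p : ℝ × ((Fin m → ℂ) × ℂ) =>
          append₂ p.2.1 (p.2.2 / 2) (p.2.2 / 2)) := (nullL m).contDiff.comp contDiff_snd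
      refine ((hof Real.contDiff_exp).smul hnull).add ?_
      rw [contDiff_pi]
      intro i
      refine Fin.lastCases ?_ (fun i => ?_) i
      · simp only [append₂, append, Fin.snoc_last]
        exact hof Real.contDiff_cosh
      · refine Fin.lastCases ?_ (fun i => ?_) i
        · simp only [append₂, append, Fin.snoc_last, Fin.snoc_castSucc]
          exact (hof Real.contDiff_sinh).neg
        · simp only [append₂, append, Fin.snoc_castSucc]
          exact contDiff_const
    exact h1.contMDiff.comp (contMDiff_fst.prodMk_space
      ((hη.smooth.comp contMDiff_snd).prodMk_space (hfs.comp contMDiff_snd)))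
  · rintro ⟨s, x⟩
    refine ⟨_, ?_, minLagAt_coneC (y := extChartAt (𝓡 m) x x)
      (φ := f ∘ (extChartAt (𝓡 m) x).symm) s (hη.minLag x)
      ((contMDiffAt_iff_chart.1 (hη.smooth x)).2.of_le two_le_infty)
      ((contMDiffAt_iff_chart.1 (hfs x)).2.of_le two_le_infty)
      (.of_forall fun y => hf.re_eq _) ?_⟩
    · rw [extChartAt_prod]
      exact .of_forall fun q => rfl
    · filter_upwards [extChartAt_target_mem_nhds (I := 𝓡 m) x] with y hy e
      exact hf.fderiv_chart hη hy e

end Products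

/-! ### Locally constant cocycles on simply connected spaces -/

section Cocycle

open Bundle in
/-- On a simply connected space, a locally constant cocycle is a coboundary of locally constant
functions: it glues trivial coverings with fibre `A` to a covering space, which has a section. -/
theorem exists_locallyConstant_of_cocycle {X A : Type*} [TopologicalSpace X]
    [SimplyConnectedSpace X] [LocallyPathConnectedSpace X] [Group A] (U : X → Set X)
    (hU : ∀ i, IsOpen (U i)) (hmem : ∀ i, i ∈ U i) (g : X → X → X → A)
    (hg : ∀ i j, ∀ x ∈ U i ∩ U j, ∀ᶠ y in 𝓝 x, g i j y = g i j x)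
    (hself : ∀ i, ∀ x ∈ U i, g i i x = 1)
    (hcomp : ∀ i j k, ∀ x ∈ U i ∩ U j ∩ U k, g j k x * g i j x = g i k x) :
    ∃ c : X → X → A, (∀ i, ∀ x ∈ U i, ∀ᶠ y in 𝓝 x, c i y = c i x) ∧
      ∀ i j, ∀ x ∈ U i ∩ U j, c j x = g i j x * c i x := by
  -- the discrete topology on the fibre makes the bundle a covering space
  let _ : TopologicalSpace A := ⊥
  have : DiscreteTopology A := ⟨rfl⟩
  let Z : FiberBundleCore X X A :=
    { baseSet := U
      isOpen_baseSet := hU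
      indexAt := id
      mem_baseSet_at := hmem
      coordChange := fun i j x a => g i j x * a
      coordChange_self := fun i x hx a => by rw [hself i x hx, one_mul]
      continuousOn_coordChange := by
        rintro i j ⟨x, a⟩ ⟨hx, -⟩
        refine ContinuousAt.continuousWithinAt ?_
        have h1 : ContinuousAt (fun p : X × A => g i j x * p.2) (x, a) :=
          (continuous_of_discreteTopology (f := fun b : A => g i j x * b)).continuousAt.comp
            continuousAt_snd
        refine h1.congr ?_
        have h2 : Tendsto Prod.fst (𝓝 (x, a)) (𝓝 x) := continuousAt_fst
        filter_upwards [h2.eventually (hg i j x hx)] with p hp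
        rw [hp]
      coordChange_comp := fun i j k x hx a => by rw [← mul_assoc, hcomp i j k x hx] }
  have hcov : IsCoveringMap (π A Z.Fiber) := FiberBundle.isCoveringMap
  obtain ⟨x₀⟩ : Nonempty X := inferInstance
  obtain ⟨σ, ⟨-, hσ⟩, -⟩ := hcov.existsUnique_continuousMap_lifts (ContinuousMap.id X) x₀
    (TotalSpace.mk x₀ (1 : A)) rfl
  have hσ' : ∀ x, (σ x).proj = x := fun x => congrFun hσ x
  refine ⟨fun i x => (Z.localTriv i (σ x)).2, fun i x hx => ?_, fun i j x hx => ?_⟩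
  · have hsrc : σ x ∈ (Z.localTriv i).source := by
      rw [Z.mem_localTriv_source, hσ' x]; exact hx
    have hc : ContinuousAt (fun y => (Z.localTriv i (σ y)).2) x :=
      continuousAt_snd.comp (((Z.localTriv i).continuousAt hsrc).comp σ.continuous.continuousAt)
    exact hc.eventually ((isOpen_discrete {(Z.localTriv i (σ x)).2}).mem_nhds rfl)
  · let a : A := (σ x).2
    change g (σ x).proj j (σ x).proj * a = g i j x * (g (σ x).proj i (σ x).proj * a)
    rw [hσ' x, ← mul_assoc, hcomp x i j x ⟨⟨hmem x, hx.1⟩, hx.2⟩]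

end Cocycle

/-! ### Horizontal lifts -/

section LocalPrimitive

variable {ε : ℤˣ} {k : ℕ} {E : Type*} [NormedAddCommGroup E] [NormedSpace ℝ E]

/-- For a map to the quadric the connection form takes imaginary values. -/
theorem herm_fderiv_self_re {u : E → Fin (k + 1) → ℂ} {y : E} (hu : DifferentiableAt ℝ u y)
    (hq : ∀ᶠ x in 𝓝 y, herm ε (u x) (u x) = ((ε : ℤ) : ℂ)) (a : E) :
    (herm ε (fderiv ℝ u y a) (u y)).re = 0 := by
  have h := congrArg Complex.re (herm_fderiv_add_eq_zero hu hu hq a)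
  rw [← conj_herm (fderiv ℝ u y a)] at h
  simp at h
  linarith

/-- The Kähler form is the imaginary part of the Hermitian form, also before projecting to the
horizontal space. -/
theorem herm_dHor_im {u : E → Fin (k + 1) → ℂ} {y : E} (hu : DifferentiableAt ℝ u y)
    (hq : ∀ᶠ x in 𝓝 y, herm ε (u x) (u x) = ((ε : ℤ) : ℂ)) (a b : E) :
    (herm ε (dHor ε u y a) (dHor ε u y b)).im = (herm ε (fderiv ℝ u y a) (fderiv ℝ u y b)).im := by
  have hqy := hq.self_of_nhds
  have h0 : herm ε (u y) (dHor ε u y b) = 0 := by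
    rw [← conj_herm, dHor, herm_horProj hqy, map_zero]
  have ha := herm_fderiv_self_re hu hq a
  have hb := herm_fderiv_self_re hu hq b
  have h1 : herm ε (dHor ε u y a) (dHor ε u y b)
      = herm ε (fderiv ℝ u y a) (fderiv ℝ u y b)
        - starRingEnd ℂ (((ε : ℤ) : ℂ) * herm ε (fderiv ℝ u y b) (u y))
          * herm ε (fderiv ℝ u y a) (u y) := by
    conv_lhs => rw [dHor, horProj, sub_eq_add_neg, ← neg_smul, herm_add_left, herm_smul_left, h0,
      mul_zero, add_zero, dHor, horProj, sub_eq_add_neg, ← neg_smul, herm_add_right,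
      herm_smul_right]
    rw [map_neg]; ring
  rw [h1]
  simp [ha, hb]

/-- A lift `u` of a Lagrangian map on a convex open set can be multiplied by a circle-valued function
`exp(iθ)` so that it becomes horizontal: the connection form is closed, and `θ` comes from the
Poincaré lemma. -/
theorem exists_horizontal_gauge [FiniteDimensional ℝ E] {u : E → Fin (k + 1) → ℂ} {S : Set E}
    (hS : IsOpen S) (hconv : Convex ℝ S) (hu : ContDiffOn ℝ ∞ u S)
    (hq : ∀ y ∈ S, herm ε (u y) (u y) = ((ε : ℤ) : ℂ))
    (hlag : ∀ y ∈ S, ∀ a b, (herm ε (fderiv ℝ u y a) (fderiv ℝ u y b)).im = 0) :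
    ∃ θ : E → ℝ, ContDiffOn ℝ ∞ θ S ∧ ∀ y ∈ S, ∀ a,
      herm ε (fderiv ℝ (fun x => (Circle.exp (θ x) : ℂ) • u x) y a)
        ((Circle.exp (θ y) : ℂ) • u y) = 0 := by
  have huy : ∀ y ∈ S, ContDiffAt ℝ 2 u y := fun y hy =>
    (hu.contDiffAt (hS.mem_nhds hy)).of_le two_le_infty
  have hud : ∀ y ∈ S, DifferentiableAt ℝ u y := fun y hy => (huy y hy).differentiableAt two_ne_zero
  -- the connection form divided by `i`, with the sign for which a primitive is the required phase
  let τ : E → E →L[ℝ] ℝ := fun y => (-((ε : ℤ) : ℝ)) •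
    (Complex.imCLM.comp (((hermL ε k).flip (u y)).comp (fderiv ℝ u y)))
  have hτ : ∀ y a, τ y a = -((ε : ℤ) : ℝ) * (herm ε (fderiv ℝ u y a) (u y)).im := fun _ _ => rfl
  have hτs : ContDiffOn ℝ ∞ τ S := by
    rw [contDiffOn_clm_apply]
    intro a
    simp only [hτ]
    have h1 : ContDiffOn ℝ ∞ (fun y => fderiv ℝ u y a) S :=
      ((contDiffOn_infty_iff_fderiv_of_isOpen hS).1 hu).2.clm_apply contDiffOn_const
    have h2 := contDiff_herm (ε := ε).comp_contDiffOn (h1.prodMk hu)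
    exact contDiffOn_const.mul (Complex.imCLM.contDiff.comp_contDiffOn h2)
  have hτd : DifferentiableOn ℝ τ S := hτs.differentiableOn (by simp)
  have hdτ : ∀ y ∈ S, ∀ a b, fderiv ℝ τ y a b
      = -((ε : ℤ) : ℝ) * (herm ε (fderiv ℝ (fderiv ℝ u) y a b) (u y)).im := by
    intro y hy a b
    have h1 : fderiv ℝ (fun x => τ x b) y a = fderiv ℝ τ y a b := by
      rw [fderiv_clm_apply (hτd.differentiableAt (hS.mem_nhds hy)) (differentiableAt_const b)]
      simp
    have hd2 := (contDiffAt_fderiv_apply (huy y hy) b).differentiableAt one_ne_zero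
    have hd3 : DifferentiableAt ℝ (fun x => herm ε (fderiv ℝ u x b) (u x)) y :=
      (contDiffAt_herm (n := 1) (WithTop.coe_le_coe.2 le_top) (contDiffAt_fderiv_apply (huy y hy) b)
        ((huy y hy).of_le (by norm_num))).differentiableAt one_ne_zero
    rw [← h1]
    simp only [hτ]
    have hd4 : DifferentiableAt ℝ (fun x => (herm ε (fderiv ℝ u x b) (u x)).im) y :=
      Complex.imCLM.differentiableAt.comp y hd3
    rw [fderiv_const_mul hd4]
    have h2 := fderiv_clm_comp Complex.imCLM hd3 a
    simp only [Complex.imCLM_apply] at h2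
    rw [smul_apply, h2, fderiv_herm hd2 (hud y hy), Complex.add_im, hlag y hy,
      fderiv_fderiv_apply (huy y hy), zero_add, smul_eq_mul]
  obtain ⟨θ, hθ⟩ := hconv.exists_forall_hasFDerivAt_of_fderiv_symmetric hS hτd fun y hy a b => by
    have hsymm : IsSymmSndFDerivAt ℝ u y := (huy y hy).isSymmSndFDerivAt (by simp)
    rw [hdτ y hy, hdτ y hy, hsymm.eq]
  refine ⟨θ, ?_, fun y hy a => ?_⟩
  · rw [contDiffOn_infty_iff_fderiv_of_isOpen hS]
    exact ⟨fun y hy => (hθ y hy).differentiableAt.differentiableWithinAt,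
      hτs.congr fun y hy => (hθ y hy).fderiv⟩
  · set c : E → ℂ := fun x => (Circle.exp (θ x) : ℂ) with hc
    have hc' : HasFDerivAt c _ y :=
      ((Complex.ofRealCLM.hasFDerivAt.comp y (hθ y hy)).mul_const Complex.I).cexp
    have hcd : fderiv ℝ c y a = c y * ((τ y a : ℂ) * Complex.I) := by
      rw [hc'.fderiv]
      simp [hc, mul_comm]
    have hcc : c y * starRingEnd ℂ (c y) = 1 := by
      rw [Complex.mul_conj, hc, Circle.normSq_coe, Complex.ofReal_one]
    have hre := herm_fderiv_self_re (hud y hy)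
      (Filter.eventually_of_mem (hS.mem_nhds hy) hq) a
    have him : herm ε (fderiv ℝ u y a) (u y)
        = ((herm ε (fderiv ℝ u y a) (u y)).im : ℂ) * Complex.I := by
      conv_lhs => rw [← Complex.re_add_im (herm ε (fderiv ℝ u y a) (u y)), hre]
      simp
    change herm ε (fderiv ℝ (fun x => c x • u x) y a) (c y • u y) = 0
    rw [fderiv_fun_smul hc'.differentiableAt (hud y hy)]
    simp only [add_apply, smul_apply, ContinuousLinearMap.smulRight_apply]
    rw [hcd, herm_smul_right, herm_add_left, herm_smul_left, herm_smul_left, hq y hy, hτ, him]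
    push_cast
    simp only [Complex.mul_I_im, Complex.ofReal_re]
    linear_combination (-c y * starRingEnd ℂ (c y)
      * ((herm ε (fderiv ℝ u y a) (u y)).im : ℂ) * Complex.I) * sign_mul_self ε

end LocalPrimitive

section Global

variable {ε : ℤˣ} {k m : ℕ} {N : Type*} [TopologicalSpace N]
  [ChartedSpace (EuclideanSpace ℝ (Fin m)) N]

/-- `K` is a horizontal lift of `φ` on the open set `W`. -/
structure IsHorizontalLiftOn (φ : N → SpaceForm ε k) (W : Set N) (K : N → Fin (k + 1) → ℂ) :
    Prop where
  isOpen : IsOpen W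
  smooth : ContMDiffOn (𝓡 m) 𝓘(ℝ, Fin (k + 1) → ℂ) ∞ K W
  lifts : ∀ x ∈ W, ∃ h : herm ε (K x) (K x) = ((ε : ℤ) : ℂ), hopf ⟨K x, h⟩ = φ x
  horizontal : ∀ x ∈ W, ∀ v : TangentSpace (𝓡 m) x,
    herm ε (mfderiv (𝓡 m) 𝓘(ℝ, Fin (k + 1) → ℂ) K x v : Fin (k + 1) → ℂ) (K x) = 0

variable {φ : N → SpaceForm ε k}

/-- The Lagrangian condition for the differential of a local lift on the manifold. -/
theorem IsMinLag.herm_mfderiv_im (hφ : IsMinLag (𝓡 m) φ) {p : N} {U : Set N}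
    {F : N → Fin (k + 1) → ℂ} (hF : IsLocalLift (𝓡 m) φ p U F) {x : N} (hx : x ∈ U)
    (a b : TangentSpace (𝓡 m) x) :
    (herm ε (mfderiv (𝓡 m) 𝓘(ℝ, Fin (k + 1) → ℂ) F x a : Fin (k + 1) → ℂ)
      (mfderiv (𝓡 m) 𝓘(ℝ, Fin (k + 1) → ℂ) F x b : Fin (k + 1) → ℂ)).im = 0 := by
  have hFx : IsLocalLift (𝓡 m) φ x U F := ⟨hF.isOpen, hx, hF.smooth, hF.lifts⟩
  have hl := (hφ.minLag x U F hFx).lagrangian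
  have hd := hFx.contDiffAt.differentiableAt (by simp)
  have hq : ∀ᶠ y in 𝓝 (extChartAt (𝓡 m) x x),
      herm ε ((F ∘ (extChartAt (𝓡 m) x).symm) y) ((F ∘ (extChartAt (𝓡 m) x).symm) y)
        = ((ε : ℤ) : ℂ) :=
    ((tendsto_extChartAt_symm (I := 𝓡 m) x).eventually (hF.isOpen.mem_nhds hx)).mono
      fun y hy => (hF.lifts _ hy).choose
  simp only [reHerm_I_smul_left, herm_dHor_im hd hq, neg_eq_zero] at hl
  have hm : MDifferentiableAt (𝓡 m) 𝓘(ℝ, Fin (k + 1) → ℂ) F x :=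
    (hF.smooth.contMDiffAt (hF.isOpen.mem_nhds hx)).mdifferentiableAt (by simp)
  have hfd : mfderiv (𝓡 m) 𝓘(ℝ, Fin (k + 1) → ℂ) F x
      = fderiv ℝ (F ∘ (extChartAt (𝓡 m) x).symm) (extChartAt (𝓡 m) x x) := by
    rw [hm.mfderiv, ModelWithCorners.range_eq_univ, fderivWithin_univ]
    rfl
  rw [hfd]
  exact hl a b

/-- Horizontal lifts exist near every point. -/
theorem IsMinLag.exists_isHorizontalLiftOn [IsManifold (𝓡 m) ∞ N] (hφ : IsMinLag (𝓡 m) φ) (p : N) :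
    ∃ W K, p ∈ W ∧ IsHorizontalLiftOn (m := m) φ W K := by
  have : IsManifold (𝓡 m) 1 N := IsManifold.of_le (n := ∞) (by simp)
  obtain ⟨U, F, hF⟩ := hφ.smooth p
  have hn : ∀ᶠ y in 𝓝 (extChartAt (𝓡 m) p p), y ∈ (extChartAt (𝓡 m) p).target
      ∧ (extChartAt (𝓡 m) p).symm y ∈ U :=
    Filter.Eventually.and (extChartAt_target_mem_nhds (I := 𝓡 m) p)
      ((tendsto_extChartAt_symm (I := 𝓡 m) p).eventually (hF.isOpen.mem_nhds hF.mem))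
  obtain ⟨r, hr, hS⟩ := Metric.mem_nhds_iff.1 hn
  set S := Metric.ball (extChartAt (𝓡 m) p p) r with hSdef
  set u := F ∘ (extChartAt (𝓡 m) p).symm with hu
  have hus : ContDiffOn ℝ ∞ u S :=
    contMDiffOn_iff_contDiffOn.1 (hF.smooth.comp
      ((contMDiffOn_extChartAt_symm p).mono fun y hy => (hS hy).1) fun y hy => (hS hy).2)
  obtain ⟨θ, hθs, hθ⟩ := exists_horizontal_gauge (ε := ε) Metric.isOpen_ball (convex_ball _ r) hus
    (fun y hy => (hF.lifts _ (hS hy).2).choose) fun y hy a b => by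
      have hm : MDifferentiableAt (𝓡 m) 𝓘(ℝ, Fin (k + 1) → ℂ) F ((extChartAt (𝓡 m) p).symm y) :=
        (hF.smooth.contMDiffAt (hF.isOpen.mem_nhds (hS hy).2)).mdifferentiableAt (by simp)
      rw [fderiv_comp_extChartAt_symm hm (hS hy).1, fderiv_comp_extChartAt_symm hm (hS hy).1]
      exact hφ.herm_mfderiv_im hF (hS hy).2 _ _
  set κ : EuclideanSpace ℝ (Fin m) → Fin (k + 1) → ℂ := fun y => (Circle.exp (θ y) : ℂ) • u y
    with hκ
  have hκs : ContDiffOn ℝ ∞ κ S := by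
    have h1 : ContDiffOn ℝ ∞ (fun y => Complex.exp ((θ y : ℂ) * Complex.I)) S :=
      ((Complex.ofRealCLM.contDiff.comp_contDiffOn hθs).mul contDiffOn_const).cexp
    exact h1.smul hus
  refine ⟨(chartAt (EuclideanSpace ℝ (Fin m)) p).source ∩ extChartAt (𝓡 m) p ⁻¹' S,
    κ ∘ extChartAt (𝓡 m) p, ⟨mem_chart_source _ p, Metric.mem_ball_self hr⟩, ?_, ?_, ?_, ?_⟩
  · have := isOpen_extChartAt_preimage (I := 𝓡 m) p (Metric.isOpen_ball (x := extChartAt (𝓡 m) p p)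
      (ε := r))
    exact this
  · exact (contMDiffOn_iff_contDiffOn.2 hκs).comp
      ((contMDiffOn_extChartAt (I := 𝓡 m) (x := p)).mono Set.inter_subset_left) fun x hx => hx.2
  · rintro x ⟨hx, hxS⟩
    have hsymm : (extChartAt (𝓡 m) p).symm (extChartAt (𝓡 m) p x) = x :=
      (extChartAt (𝓡 m) p).left_inv (by rwa [extChartAt_source])
    obtain ⟨h, h'⟩ := hF.lifts x (by have := (hS hxS).2; rwa [hsymm] at this)
    have hval : (κ ∘ extChartAt (𝓡 m) p) x
        = (Circle.exp (θ (extChartAt (𝓡 m) p x)) : ℂ) • F x := by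
      simp only [hκ, hu, Function.comp, hsymm]
    have hcc : ∀ c : Circle, (c : ℂ) * starRingEnd ℂ (c : ℂ) = 1 := fun c => by
      rw [Complex.mul_conj]; simp
    rw [hval]
    have hh : herm ε ((Circle.exp (θ (extChartAt (𝓡 m) p x)) : ℂ) • F x)
        ((Circle.exp (θ (extChartAt (𝓡 m) p x)) : ℂ) • F x) = ((ε : ℤ) : ℂ) := by
      rw [herm_smul_left, herm_smul_right, ← mul_assoc, hcc, one_mul, h]
    refine ⟨hh, ?_⟩
    rw [← h']
    exact (hopf_eq_iff.2 ⟨_, rfl⟩).symm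
  · rintro x ⟨hx, hxS⟩ v
    have h1 : MDifferentiableAt 𝓘(ℝ, EuclideanSpace ℝ (Fin m)) 𝓘(ℝ, Fin (k + 1) → ℂ) κ
        (extChartAt (𝓡 m) p x) :=
      ((hκs.contDiffAt (Metric.isOpen_ball.mem_nhds hxS)).differentiableAt
        (by simp)).mdifferentiableAt
    rw [mfderiv_comp x h1 (mdifferentiableAt_extChartAt hx), mfderiv_eq_fderiv]
    exact hθ _ hxS _

theorem IsHorizontalLiftOn.fderiv_chart [IsManifold (𝓡 m) ∞ N] {W : Set N}
    {K : N → Fin (k + 1) → ℂ} (hK : IsHorizontalLiftOn (m := m) φ W K) {p : N}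
    {y : EuclideanSpace ℝ (Fin m)} (hy : y ∈ (extChartAt (𝓡 m) p).target)
    (hW : (extChartAt (𝓡 m) p).symm y ∈ W) :
    DifferentiableAt ℝ (K ∘ (extChartAt (𝓡 m) p).symm) y ∧ ∀ a,
      herm ε (fderiv ℝ (K ∘ (extChartAt (𝓡 m) p).symm) y a)
        ((K ∘ (extChartAt (𝓡 m) p).symm) y) = 0 := by
  have : IsManifold (𝓡 m) 1 N := IsManifold.of_le (n := ∞) (by simp)
  have hm : MDifferentiableAt (𝓡 m) 𝓘(ℝ, Fin (k + 1) → ℂ) K ((extChartAt (𝓡 m) p).symm y) :=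
    (hK.smooth.contMDiffAt (hK.isOpen.mem_nhds hW)).mdifferentiableAt (by simp)
  have h1 : MDifferentiableAt 𝓘(ℝ, EuclideanSpace ℝ (Fin m)) (𝓡 m) (extChartAt (𝓡 m) p).symm y := by
    have := mdifferentiableWithinAt_extChartAt_symm (I := 𝓡 m) hy
    rwa [ModelWithCorners.range_eq_univ, mdifferentiableWithinAt_univ] at this
  refine ⟨(hm.comp y h1).differentiableAt, fun a => ?_⟩
  rw [fderiv_comp_extChartAt_symm hm hy]
  exact hK.horizontal _ hW _

/-- Two horizontal lifts differ by a locally constant factor. -/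
theorem IsHorizontalLiftOn.eventually_eq [IsManifold (𝓡 m) ∞ N] {W W' : Set N}
    {K K' : N → Fin (k + 1) → ℂ} (hK : IsHorizontalLiftOn (m := m) φ W K)
    (hK' : IsHorizontalLiftOn (m := m) φ W' K') {c : N → Circle}
    (hc : ∀ x ∈ W ∩ W', K x = (c x : ℂ) • K' x) {p : N} (hp : p ∈ W ∩ W') :
    ∀ᶠ x in 𝓝 p, c x = c p := by
  -- `C` extends the factor to a function whose differential can be computed from horizontality
  set C : N → ℂ := fun x => ((ε : ℤ) : ℂ) * herm ε (K x) (K' x) with hC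
  have hCc : ∀ x ∈ W ∩ W', C x = c x := by
    intro x hx
    simp only [hC]
    rw [hc x hx, herm_smul_left, (hK'.lifts x hx.2).choose]
    linear_combination (c x : ℂ) * sign_mul_self ε
  have hWW : IsOpen (W ∩ W') := hK.isOpen.inter hK'.isOpen
  have hn : ∀ᶠ y in 𝓝 (extChartAt (𝓡 m) p p), y ∈ (extChartAt (𝓡 m) p).target
      ∧ (extChartAt (𝓡 m) p).symm y ∈ W ∩ W' :=
    Filter.Eventually.and (extChartAt_target_mem_nhds (I := 𝓡 m) p)
      ((tendsto_extChartAt_symm (I := 𝓡 m) p).eventually (hWW.mem_nhds hp))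
  obtain ⟨r, hr, hS⟩ := Metric.mem_nhds_iff.1 hn
  have hder : ∀ y ∈ Metric.ball (extChartAt (𝓡 m) p p) r,
      HasFDerivAt (C ∘ (extChartAt (𝓡 m) p).symm) (0 : EuclideanSpace ℝ (Fin m) →L[ℝ] ℂ) y := by
    intro y hy
    obtain ⟨hyt, hyW⟩ := hS hy
    obtain ⟨hd, hh⟩ := hK.fderiv_chart hyt hyW.1
    obtain ⟨hd', hh'⟩ := hK'.fderiv_chart hyt hyW.2
    have hcy := hc _ hyW
    have hcn := (c ((extChartAt (𝓡 m) p).symm y)).coe_ne_zero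
    have hdiff : DifferentiableAt ℝ (fun y => herm ε ((K ∘ (extChartAt (𝓡 m) p).symm) y)
        ((K' ∘ (extChartAt (𝓡 m) p).symm) y)) y :=
      (contDiff_herm.differentiable (by simp)).differentiableAt.comp y (hd.prodMk hd')
    have hz : fderiv ℝ (fun y => herm ε ((K ∘ (extChartAt (𝓡 m) p).symm) y)
        ((K' ∘ (extChartAt (𝓡 m) p).symm) y)) y = 0 := by
      ext a
      rw [fderiv_herm hd hd', zero_apply]
      have h1 : herm ε ((K ∘ (extChartAt (𝓡 m) p).symm) y)
          (fderiv ℝ (K' ∘ (extChartAt (𝓡 m) p).symm) y a) = 0 := by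
        rw [Function.comp, hcy, herm_smul_left, ← conj_herm]
        have := hh' a
        simp only [Function.comp_apply] at this
        rw [this]; simp
      have h2 := hh a
      simp only [Function.comp_apply] at h2
      rw [hcy, herm_smul_right] at h2
      have h3 := (mul_eq_zero.1 h2).resolve_left ((map_ne_zero _).2 hcn)
      rw [h1, zero_add]
      exact h3
    have := hdiff.hasFDerivAt.const_mul ((ε : ℤ) : ℂ)
    rw [hz] at this
    exact this.congr_fderiv (by ext a; simp)
  have hconst : ∀ y ∈ Metric.ball (extChartAt (𝓡 m) p p) r,
      C ((extChartAt (𝓡 m) p).symm y) = C p := by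
    intro y hy
    have := Metric.isOpen_ball.is_const_of_fderiv_eq_zero (𝕜 := ℝ)
      (convex_ball (extChartAt (𝓡 m) p p) r).isPreconnected
      (fun y hy => (hder y hy).differentiableAt.differentiableWithinAt)
      (fun y hy => (hder y hy).fderiv) hy (Metric.mem_ball_self hr)
    simpa using this
  filter_upwards [hWW.mem_nhds hp, extChartAt_source_mem_nhds (I := 𝓡 m) p,
    (continuousAt_extChartAt (I := 𝓡 m) p).eventually (Metric.ball_mem_nhds _ hr)] with x hx hxs hxb
  have := hconst _ hxb
  rw [(extChartAt (𝓡 m) p).left_inv hxs, hCc x hx, hCc p hp] at this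
  exact Circle.coe_injective this

/-- A minimal Lagrangian immersion of a simply connected manifold has a horizontal lift. -/
theorem IsMinLag.exists_isHorizontalLift [IsManifold (𝓡 m) ∞ N] [SimplyConnectedSpace N]
    (hφ : IsMinLag (𝓡 m) φ) : ∃ G, IsHorizontalLift (𝓡 m) φ G := by
  have : LocallyPathConnectedSpace N :=
    ChartedSpace.locallyPathConnectedSpace (EuclideanSpace ℝ (Fin m)) N
  choose W K hmem hK using hφ.exists_isHorizontalLiftOn
  have hne : ∀ i, ∀ x ∈ W i, K i x ≠ 0 := by
    intro i x hx h0
    have h := ((hK i).lifts x hx).choose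
    rw [h0, herm_zero_left] at h
    have := sign_mul_self ε
    rw [← h] at this
    simp at this
  have hg : ∀ i j x, ∃ c : Circle, x ∈ W i ∩ W j → K i x = (c : ℂ) • K j x := by
    intro i j x
    by_cases hx : x ∈ W i ∩ W j
    · obtain ⟨h1, h1'⟩ := (hK i).lifts x hx.1
      obtain ⟨h2, h2'⟩ := (hK j).lifts x hx.2
      obtain ⟨c, hc⟩ := hopf_eq_iff.1 (h2'.trans h1'.symm)
      exact ⟨c, fun _ => hc⟩
    · exact ⟨1, fun h => absurd h hx⟩
  choose g hg using hg
  obtain ⟨c, hc, hcg⟩ := exists_locallyConstant_of_cocycle W (fun i => (hK i).isOpen) hmem g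
    (fun i j x hx => (hK i).eventually_eq (hK j) (fun x hx => hg i j x hx) hx)
    (fun i x hx => by
      have := hg i i x ⟨hx, hx⟩
      have h1 : ((g i i x : ℂ) - 1) • K i x = 0 := by rw [sub_smul, ← this, one_smul, sub_self]
      have h2 := (smul_eq_zero.1 h1).resolve_right (hne i x hx)
      exact Circle.coe_injective (by simpa using sub_eq_zero.1 h2))
    (fun i j l x hx => by
      have h1 := hg i j x hx.1
      rw [hg j l x ⟨hx.1.2, hx.2⟩, smul_smul, hg i l x ⟨hx.1.1, hx.2⟩] at h1
      have h2 := smul_left_injective ℂ (hne l x hx.2) h1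
      refine Circle.coe_injective ?_
      rw [Circle.coe_mul, mul_comm]
      exact h2.symm)
  have hglue : ∀ i, ∀ x ∈ W i, (c x x : ℂ) • K x x = (c i x : ℂ) • K i x := by
    intro i x hx
    rw [hcg i x x ⟨hx, hmem x⟩, hg i x x ⟨hx, hmem x⟩, smul_smul, Circle.coe_mul, mul_comm]
  have hlift : ∀ x, ∃ h : herm ε ((c x x : ℂ) • K x x) ((c x x : ℂ) • K x x) = ((ε : ℤ) : ℂ),
      hopf ⟨(c x x : ℂ) • K x x, h⟩ = φ x := by
    intro x
    obtain ⟨h, h'⟩ := (hK x).lifts x (hmem x)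
    have hcc : (c x x : ℂ) * starRingEnd ℂ (c x x : ℂ) = 1 := by
      rw [Complex.mul_conj]; simp
    refine ⟨by rw [herm_smul_left, herm_smul_right, ← mul_assoc, hcc, one_mul, h], ?_⟩
    rw [← h']
    exact (hopf_eq_iff.2 ⟨_, rfl⟩).symm
  have hloc : ∀ i, (fun x => (c x x : ℂ) • K x x) =ᶠ[𝓝 i] fun x => (c i i : ℂ) • K i x := by
    intro i
    filter_upwards [(hK i).isOpen.mem_nhds (hmem i), hc i i (hmem i)] with x hx hcx
    rw [hglue i x hx, hcx]
  have hsm : ∀ i, ContMDiffAt (𝓡 m) 𝓘(ℝ, Fin (k + 1) → ℂ) ∞ (K i) i := fun i =>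
    (hK i).smooth.contMDiffAt ((hK i).isOpen.mem_nhds (hmem i))
  let L : ℂ → (Fin (k + 1) → ℂ) →L[ℝ] (Fin (k + 1) → ℂ) := fun a =>
    (a • ContinuousLinearMap.id ℂ (Fin (k + 1) → ℂ)).restrictScalars ℝ
  refine ⟨fun x => ⟨(c x x : ℂ) • K x x, (hlift x).choose⟩, fun i => ?_,
    fun x => (hlift x).choose_spec, fun i v => ?_⟩
  · exact ((L (c i i)).contDiff.contMDiff.contMDiffAt.comp i (hsm i)).congr_of_eventuallyEq (hloc i)
  · have h1 : mfderiv (𝓡 m) 𝓘(ℝ, Fin (k + 1) → ℂ) (fun x => (c x x : ℂ) • K x x) i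
        = (L (c i i)).comp (mfderiv (𝓡 m) 𝓘(ℝ, Fin (k + 1) → ℂ) (K i) i) := by
      rw [(hloc i).mfderiv_eq]
      have := mfderiv_comp i (L (c i i)).differentiableAt.mdifferentiableAt
        ((hsm i).mdifferentiableAt (by simp))
      rw [mfderiv_eq_fderiv, ContinuousLinearMap.fderiv] at this
      exact this
    simp only
    rw [h1]
    let D : Fin (k + 1) → ℂ := mfderiv (𝓡 m) 𝓘(ℝ, Fin (k + 1) → ℂ) (K i) i v
    have hD : herm ε D (K i i) = 0 := (hK i).horizontal i (hmem i) v
    change herm ε ((c i i : ℂ) • D) ((c i i : ℂ) • K i i) = 0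
    rw [herm_smul_left, herm_smul_right, hD, mul_zero, mul_zero]

end Global

end MinLag

end

theorem proposition4 {m : ℕ} {N : Type*} [TopologicalSpace N] [T2Space N]
    [SecondCountableTopology N] [ChartedSpace (EuclideanSpace ℝ (Fin m)) N]
    [IsManifold (𝓡 m) ∞ N] :
    (∀ φ : N → MinLag.CP m, MinLag.IsMinLag (𝓡 m) φ →
      (SimplyConnectedSpace N → ∃ G, MinLag.IsHorizontalLift (𝓡 m) φ G) ∧
      ∀ G, MinLag.IsHorizontalLift (𝓡 m) φ G →
        MinLag.IsMinLag (𝓘(ℝ, ℝ).prod (𝓡 m)) (MinLag.mapA G)) ∧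
    (∀ ψ : N → MinLag.CH m, MinLag.IsMinLag (𝓡 m) ψ →
      (SimplyConnectedSpace N → ∃ G, MinLag.IsHorizontalLift (𝓡 m) ψ G) ∧
      ∀ G, MinLag.IsHorizontalLift (𝓡 m) ψ G →
        MinLag.IsMinLag (𝓘(ℝ, ℝ).prod (𝓡 m)) (MinLag.mapB G)) ∧
    (∀ (η : N → Fin m → ℂ) (f : N → ℂ), MinLag.IsMinLagFlat (𝓡 m) η →
      ∀ hf : MinLag.IsPotential (𝓡 m) η f,
        MinLag.IsMinLag (𝓘(ℝ, ℝ).prod (𝓡 m)) (MinLag.mapC η f hf.re_eq)) := by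
  refine ⟨fun φ hφ => ⟨fun _ => hφ.exists_isHorizontalLift, fun G hG => ?_⟩,
    fun ψ hψ => ⟨fun _ => hψ.exists_isHorizontalLift, fun G hG => ?_⟩, fun η f hη hf => ?_⟩
  · exact MinLag.isMinLag_mapA hφ hG
  · exact MinLag.isMinLag_mapB hψ hG
  · exact MinLag.isMinLag_mapC hη hf
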